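/- Let $\mathcal T$ be a locally finite tree without vertices of degree $1$, with vertex set $V\mathcal T$ and space of ends $\partial\mathcal T$ (with its usual compact topology), and give $\mathrm{Aut}(\mathcal T)$ the permutation topology (pointwise convergence on $V\mathcal T$). Let $G$ be a closed subgroup of $\mathrm{Aut}(\mathcal T)$ that fixes an end $\xi$ and acts transitively on $X=\partial\mathcal T\setminus\{\xi\}$. Let $\xi'\in X$, let $\mathcal L$ be the line between $\xi$ and $\xi'$, and let $H=G_{\xi'}$ be the stabilizer of $\xi'$ in $G$. A *translation of length $l>0$ towards an end $\eta$* is an automorphism that shifts some bi-infinite line having $\eta$ as an end by $l$ in the direction of $\eta$; $G$ *acts without translation* if no element of $G$ is a translation. *Horospheres around $\xi$* are the classes of the relation: $v\sim w$ if $d(v,x_n)=d(w,x_n)$ for all large $n$, where $(x_n)$ is a ray representing $\xi$. The distance between two horospheres is the minimal distance between their vertices. A topological group is *compactly generated* if it is generated by a compact subset. For a $G$-space $Y$, a *$G$-kernel* is a closed $G$-invariant equivalence relation, and a *$G$-factor* is the corresponding quotient map $\pi:Y\to Z$ (up to identification of the target). It is of *type (C)* if $Z$ has an open cover by sets whose preimages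 have compact closure; of *type (D)* if $Y$ has an open cover by sets on which $\pi$ is injective; of *type (I)* if its $G$-kernel is nontrivial and properly contains no $G$-kernel other than the trivial one. A *(CDI) factorization* of $Y$ is a finite sequence of $G$-factors, each of type (C), (D) or (I), starting at $Y$ and ending at a one-point space. Then $H$ is compactly generated, and exactly one of the following holds. 1. (Isolated end case) $\xi$ is an isolated point of $\partial\mathcal T$, $X$ is compact, and $G$ acts without translation. 2. (Lineal case) $\mathcal T=\mathcal L$, and $G=H\cong\mathbb Z$ (as topological groups, with $\mathbb Z$ discrete), every nontrivial element of $G$ being a translation. 3. (Horocyclic case) $\xi$ is an accumulation point of $\partial\mathcal T$ and $G$ acts without translation. For every $v\in V\mathcal L$ one has $H\le G_v$, and $X\to G/G_v\to\{*\}$, with first map $g\xi'\mapsto gG_v$, is a (CDI) factorization of $X$. Every compactly generated subgroup of $G$ fixes a vertex of $\mathcal T$; $G$ is not compactly generated; $G$ preserves each horosphere around $\xi$ and has infinitely many orbits on $V\mathcal T$. 4. (Focal case) There are an integer $l>0$ and a translation $s\in G$ of length $l$ towards $\xi$ such that $H=U_0\rtimes\langle s\rangle$ as a topological group, where $U_0$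 is the pointwise fixator of $\mathcal L$ in $G$. The space $\partial\mathcal T$ is homeomorphic to the Cantor set. $G$ has exactly $l$ orbits on $V\mathcal T$; each orbit is a union of horospheres around $\xi$, and two horospheres around $\xi$ lie in the same orbit if and only if the distance between them is a multiple of $l$. Moreover $G$ is compactly generated. -/

import Mathlib

open Set Filter Topology
open scoped Pointwise

namespace TreeEnds

section Generalities

/-- A subgroup `K` of a topological group is compactly generated: it is generated by a compact
set. -/
def IsCompactlyGenerated {A : Type*} [Group A] [TopologicalSpace A] (K : Subgroup A) : Prop :=
  ∃ S : Set A, IsCompact S ∧ Subgroup.closure S = K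

/-- `K = N ⋊ Q` as an internal semidirect product of topological groups: `N` and `Q` are subgroups
of `K`, `N` is normalized by `K`, `N ∩ Q = 1`, `K = N Q`, and the multiplication map
`N × Q → K` is a homeomorphism. -/
structure IsSemidirectDecomposition {A : Type*} [Group A] [TopologicalSpace A]
    (K N Q : Subgroup A) : Prop where
  left_le : N ≤ K
  right_le : Q ≤ K
  normal : ∀ k ∈ K, ∀ n ∈ N, k * n * k⁻¹ ∈ N
  disjoint : N ⊓ Q = ⊥
  mul_eq : (N : Set A) * (Q : Set A) = (K : Set A)
  isEmbedding : IsEmbedding (fun p : N × Q => (p.1 : A) * (p.2 : A))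

variable (Γ : Type*) [Group Γ]

/-- A `Γ`-kernel on a `Γ`-space: a closed `Γ`-invariant equivalence relation. -/
def IsKernel {X : Type*} [TopologicalSpace X] [MulAction Γ X] (R : Setoid X) : Prop :=
  IsClosed {p : X × X | R p.1 p.2} ∧ ∀ (g : Γ) (x y : X), R x y → R (g • x) (g • y)

/-- A `Γ`-factor: an equivariant map that is, up to identification of the target, the quotient map
by a `Γ`-kernel. -/
def IsFactor {X Y : Type*} [TopologicalSpace X] [MulAction Γ X] [TopologicalSpace Y]
    [MulAction Γ Y] (π : X → Y) : Prop :=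
  IsQuotientMap π ∧ (∀ (g : Γ) (x : X), π (g • x) = g • π x) ∧ IsKernel Γ (Setoid.ker π)

/-- Type (C): the target has an open cover by sets whose preimages have compact closure. -/
def IsTypeC {X Y : Type*} [TopologicalSpace X] [TopologicalSpace Y] (π : X → Y) : Prop :=
  ∃ 𝒪 : Set (Set Y), (∀ O ∈ 𝒪, IsOpen O) ∧ ⋃₀ 𝒪 = univ ∧
    ∀ O ∈ 𝒪, IsCompact (closure (π ⁻¹' O))

/-- Type (D): the source has an open cover by sets on which the map is injective. -/
def IsTypeD {X Y : Type*} [TopologicalSpace X] (π : X → Y) : Prop :=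
  ∃ 𝒪 : Set (Set X), (∀ O ∈ 𝒪, IsOpen O) ∧ ⋃₀ 𝒪 = univ ∧ ∀ O ∈ 𝒪, InjOn π O

/-- Type (I): the kernel is nontrivial, and the only kernel properly contained in it is the
trivial one. -/
def IsTypeI {X Y : Type*} [TopologicalSpace X] [MulAction Γ X] (π : X → Y) : Prop :=
  Setoid.ker π ≠ ⊥ ∧ ∀ R : Setoid X, IsKernel Γ R → R < Setoid.ker π → R = ⊥

/-- A two-step (CDI) factorization `X → Y → {*}`: both maps are `Γ`-factors, and each of them is of
type (C), (D) or (I). -/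
def IsCDIFactorization {X Y : Type*} [TopologicalSpace X] [MulAction Γ X] [TopologicalSpace Y]
    [MulAction Γ Y] (π₁ : X → Y) (π₂ : Y → PUnit.{1}) : Prop :=
  (IsFactor Γ π₁ ∧ (IsTypeC π₁ ∨ IsTypeD π₁ ∨ IsTypeI Γ π₁)) ∧
  (IsFactor Γ π₂ ∧ (IsTypeC π₂ ∨ IsTypeD π₂ ∨ IsTypeI Γ π₂))

end Generalities

variable {V : Type*} (T : SimpleGraph V)

/-- No vertex has exactly one neighbour. -/
def Leafless : Prop := ∀ v : V, ¬ ∃! w : V, T.Adj v w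

/-- The permutation topology on the automorphism group: pointwise convergence on the
discrete set of vertices. -/
instance instTopologicalSpaceAut : TopologicalSpace (T ≃g T) :=
  TopologicalSpace.induced (fun (g : T ≃g T) (v : V) => g v)
    (@Pi.topologicalSpace V (fun _ => V) (fun _ => ⊥))

/-- A ray: a one-way infinite path without repetitions. -/
structure Ray where
  toFun : ℕ → V
  adj : ∀ n, T.Adj (toFun n) (toFun (n + 1))
  inj : Function.Injective toFun

/-- A (bi-infinite) line: a two-way infinite path without repetitions. -/
structure Line where
  toFun : ℤ → V
  adj : ∀ n, T.Adj (toFun n) (toFun (n + 1))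
  inj : Function.Injective toFun

variable {T}

/-- Two rays are cofinal if they agree after deleting suitable initial segments. -/
instance raySetoid : Setoid (Ray T) where
  r a b := ∃ m n : ℕ, ∀ k, a.toFun (m + k) = b.toFun (n + k)
  iseqv :=
    { refl := fun _ => ⟨0, 0, fun _ => rfl⟩
      symm := fun ⟨m, n, h⟩ => ⟨n, m, fun k => (h k).symm⟩
      trans := by
        rintro a b c ⟨m, n, h⟩ ⟨p, q, h'⟩
        refine ⟨m + p, q + n, fun k => ?_⟩
        rw [add_assoc, h, add_assoc, ← h']
        congr 1
        omega }

variable (T) in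
/-- The ends of a tree: cofinality classes of rays. -/
def Ends : Type _ := Quotient (raySetoid (T := T))

/-- The end represented by a ray. -/
def Ray.toEnd (r : Ray T) : Ends T := Quotient.mk _ r

/-- The usual topology on the set of ends, generated by the sets of ends lying on a given side of
an edge: for adjacent `u`, `w`, the ends represented by a ray that starts with `u, w`. -/
instance instTopologicalSpaceEnds : TopologicalSpace (Ends T) :=
  TopologicalSpace.generateFrom
    {A | ∃ u w : V, T.Adj u w ∧
      A = {η | ∃ r : Ray T, r.toFun 0 = u ∧ r.toFun 1 = w ∧ r.toEnd = η}}

/-- The image of a ray under an automorphism. -/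
def Ray.map (g : T ≃g T) (r : Ray T) : Ray T where
  toFun n := g (r.toFun n)
  adj n := g.map_adj_iff.2 (r.adj n)
  inj := g.injective.comp r.inj

/-- The action of the automorphism group on the ends. -/
instance instMulActionEnds : MulAction (T ≃g T) (Ends T) where
  smul g := Quotient.map (Ray.map g) (by
    rintro a b ⟨m, n, h⟩
    exact ⟨m, n, fun k => congrArg g (h k)⟩)
  one_smul η := by
    induction η using Quotient.inductionOn
    rfl
  mul_smul g h η := by
    induction η using Quotient.inductionOn
    rfl

/-- The end towards which the line runs in the positive direction. -/
def Line.posEnd (L : Line T) : Ends T :=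
  Ray.toEnd
    { toFun := fun n => L.toFun n
      adj := fun n => by simpa using L.adj n
      inj := fun a b h => by simpa using L.inj h }

/-- The end towards which the line runs in the negative direction. -/
def Line.negEnd (L : Line T) : Ends T :=
  Ray.toEnd
    { toFun := fun n => L.toFun (-(n : ℤ))
      adj := fun n => by
        have h := (L.adj (-(n : ℤ) - 1)).symm
        rw [sub_add_cancel] at h
        rwa [Nat.cast_add, Nat.cast_one, neg_add, ← sub_eq_add_neg]
      inj := fun a b h => by simpa using L.inj h }

/-- The vertex set of the line between two ends. -/
def lineBetween (ξ ξ' : Ends T) : Set V :=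
  {v | ∃ L : Line T, L.negEnd = ξ' ∧ L.posEnd = ξ ∧ v ∈ range L.toFun}

/-- `g` is a translation of length `l > 0` towards the end `ξ`: it shifts some line by `l` in the
direction of `ξ`. -/
def IsTranslationTowards (g : T ≃g T) (l : ℕ) (ξ : Ends T) : Prop :=
  0 < l ∧ ∃ L : Line T, L.posEnd = ξ ∧ ∀ n : ℤ, g (L.toFun n) = L.toFun (n + l)

/-- `g` is a translation (a hyperbolic automorphism). -/
def IsTranslation (g : T ≃g T) : Prop :=
  ∃ (l : ℕ) (ξ : Ends T), IsTranslationTowards g l ξ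

/-- The horosphere around `ξ` through `v`: the vertices `w` with the same Busemann value as `v`,
that is, with `d(v, x_n) = d(w, x_n)` for all large `n`, where `(x_n)` is a ray representing `ξ`. -/
def horosphere (ξ : Ends T) (v : V) : Set V :=
  {w | ∃ x : Ray T, x.toEnd = ξ ∧ ∀ᶠ n in atTop, T.dist v (x.toFun n) = T.dist w (x.toFun n)}

/-- `A` is a horosphere around `ξ`. -/
def IsHorosphere (ξ : Ends T) (A : Set V) : Prop := ∃ v : V, A = horosphere ξ v

variable (T) in
/-- The distance between two (nonempty) sets of vertices. -/
noncomputable def setDist (A B : Set V) : ℕ :=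
  sInf {d | ∃ a ∈ A, ∃ b ∈ B, d = T.dist a b}

/-- The `G`-space of ends other than the fixed end `ξ`. -/
def otherEnds (G : Subgroup (T ≃g T)) (ξ : Ends T) (hfix : ∀ g : G, g • ξ = ξ) :
    SubMulAction G (Ends T) where
  carrier := {η | η ≠ ξ}
  smul_mem' g η hη h := hη (by
    rw [← inv_smul_smul g η, h]
    exact hfix g⁻¹)

/-- The pointwise fixator in `G` of the line between `ξ` and `ξ'`. -/
def lineFixator (G : Subgroup (T ≃g T)) (ξ ξ' : Ends T) : Subgroup G :=
  fixingSubgroup G (lineBetween ξ ξ')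

/-- `G` acts without translation. -/
def ActsWithoutTranslation (G : Subgroup (T ≃g T)) : Prop :=
  ∀ g ∈ G, ¬ IsTranslation g

/-- Isolated end case. -/
structure IsolatedEndCase (G : Subgroup (T ≃g T)) (ξ : Ends T) : Prop where
  isolated : IsOpen ({ξ} : Set (Ends T))
  compact : IsCompact {η : Ends T | η ≠ ξ}
  without_translation : ActsWithoutTranslation G

/-- Lineal case: the tree is the line between `ξ` and `ξ'`, `G` fixes `ξ'`, and `G` is isomorphic
as a topological group to the discrete group `ℤ`, the nontrivial elements being translations. -/
structure LinealCase (G : Subgroup (T ≃g T)) (ξ ξ' : Ends T) : Prop where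
  eq_line : lineBetween ξ ξ' = univ
  eq_stabilizer : MulAction.stabilizer G ξ' = ⊤
  eq_int : Nonempty (G ≃ₜ* Multiplicative ℤ)
  translation : ∀ g ∈ G, g ≠ 1 → IsTranslation g

/-- Horocyclic case. -/
structure HorocyclicCase (G : Subgroup (T ≃g T)) (ξ ξ' : Ends T)
    (hfix : ∀ g : G, g • ξ = ξ) (hne : ξ' ≠ ξ) : Prop where
  accumulation : AccPt ξ (𝓟 (univ : Set (Ends T)))
  without_translation : ActsWithoutTranslation G
  stabilizer_le : ∀ v ∈ lineBetween ξ ξ', MulAction.stabilizer G ξ' ≤ MulAction.stabilizer G v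
  /-- The factorization `X → G/G_v → {*}`, the first map being `g ξ' ↦ g G_v`. -/
  factorization : ∀ v ∈ lineBetween ξ ξ',
    ∃ π : otherEnds G ξ hfix → G ⧸ MulAction.stabilizer G v,
      (∀ g : G, π (g • (⟨ξ', hne⟩ : otherEnds G ξ hfix)) = (g : G ⧸ MulAction.stabilizer G v)) ∧
      IsCDIFactorization G π (fun _ => PUnit.unit)
  fixes_vertex : ∀ K : Subgroup G, IsCompactlyGenerated K → ∃ v : V, ∀ g ∈ K, g • v = v
  not_compactlyGenerated : ¬ IsCompactlyGenerated (⊤ : Subgroup G)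
  preserves_horospheres : ∀ (g : G) (A : Set V), IsHorosphere ξ A → g • A = A
  infinite_orbits : Infinite (MulAction.orbitRel.Quotient G V)

/-- Focal case. -/
structure FocalCase (G : Subgroup (T ≃g T)) (ξ ξ' : Ends T) : Prop where
  cantor : Nonempty (Ends T ≃ₜ cantorSet)
  compactlyGenerated : IsCompactlyGenerated (⊤ : Subgroup G)
  exists_translation : ∃ (s : G) (l : ℕ),
    IsTranslationTowards (s : T ≃g T) l ξ ∧
    IsSemidirectDecomposition (MulAction.stabilizer G ξ') (lineFixator G ξ ξ')
      (Subgroup.zpowers s) ∧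
    Nat.card (MulAction.orbitRel.Quotient G V) = l ∧
    (∀ v : V, ∃ 𝒜 : Set (Set V), (∀ A ∈ 𝒜, IsHorosphere ξ A) ∧ MulAction.orbit G v = ⋃₀ 𝒜) ∧
    (∀ A B : Set V, IsHorosphere ξ A → IsHorosphere ξ B →
      ((∃ v : V, A ⊆ MulAction.orbit G v ∧ B ⊆ MulAction.orbit G v) ↔ l ∣ setDist T A B))

end TreeEnds

namespace TreeEnds

variable {V : Type*} {T : SimpleGraph V}

/-! ### Rays in a tree. -/

section Rays

/-! The fixed end `ξ` hangs the tree from above: every vertex has a `parent`, its neighbour towards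
`ξ`, and there is a `height` growing by one at each parent. Ends other than `ξ` correspond to
branches, i.e. sequences `y : ℤ → V` of successive parents with `y n` at height `n`. The `shadow` of
`v` consists of the ends whose branch passes through `v`; shadows and their complements generate the
topology. Elements of `G` commute with `parent`, hence change all heights by the same amount, and
this gives a homomorphism `shift` from `G` to `ℤ`. An element fixing `ξ'` acts on its branch by
adding the shift to the index.

If the shift vanishes, every element fixes all sufficiently remote ancestors of any vertex
(`exists_fixed_iterate`). So nothing is a translation, and `G` is the increasing union of the open
stabilizers of the `y n`, whence a compact set lies in one of them. A vertex fixed by all of `G`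
would have an ancestor on the branch of `ξ'`, and by transitivity on every branch, so `ξ` would be
isolated. This separates the isolated from the horocyclic case.

If the shift is nontrivial, an element of minimal positive shift `l` has a repelling end, which
transitivity conjugates to `ξ'` (`exists_minimal_translation`). The resulting `s` splits the
stabilizer of `ξ'`. If `ξ'` is the only other end, leaflessness forces the tree to be the line.
Otherwise the dynamics of `s` exclude isolated ends (`not_isOpen_singleton`), and Brouwer's
characterization yields the Cantor set. Transitivity on ends brings each vertex onto the branch of
`ξ'`, so orbits are the classes of heights modulo `l`; a vertex stabilizer and `s` generate `G`. -/

theorem eq_of_adj_of_dist (hT : T.IsTree) {a u v w : V} (hu : T.Adj v u) (hw : T.Adj v w)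
    (hdu : T.dist a v = T.dist a u + 1) (hdw : T.dist a v = T.dist a w + 1) : u = w := by
  have key : ∀ x, T.Adj v x → T.dist a v = T.dist a x + 1 →
      ∀ p : T.Walk a v, p.IsPath → x = p.penultimate := by
    intro x hx hd p hp
    classical
    obtain ⟨q, hq, hql⟩ := hT.connected.exists_path_of_dist a x
    have hv : v ∉ q.support := by
      intro hmem
      have h1 := T.dist_le (q.takeUntil v hmem)
      have h2 := q.length_takeUntil_le_length hmem
      omega
    have hp' := hq.concat hv hx.symm
    have : p = q.concat hx.symm := (hT.existsUnique_path a v).unique hp hp'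
    rw [this, SimpleGraph.Walk.penultimate_concat]
  obtain ⟨p, hp, -⟩ := hT.existsUnique_path a v
  rw [key u hu hdu p hp, key w hw hdw p hp]

/-- In a tree, a walk without backtracking is geodesic. -/
theorem dist_of_nonbacktracking (hT : T.IsTree) (f : ℕ → V) (hadj : ∀ n, T.Adj (f n) (f (n + 1)))
    (hne : ∀ n, f n ≠ f (n + 2)) (n : ℕ) : T.dist (f 0) (f n) = n := by
  induction n using Nat.strong_induction_on with
  | _ n ih =>
    match n with
    | 0 => simp
    | 1 => exact SimpleGraph.dist_eq_one_iff_adj.2 (hadj 0)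
    | n + 2 =>
      have h0 := ih n (by omega)
      have h1 := ih (n + 1) (by omega)
      rcases hT.dist_eq_dist_add_one_of_adj (f 0) (hadj (n + 1)) with h | h
      -- If the distance drops, `f n` and `f (n + 2)` are both the neighbour of `f (n + 1)` nearer
      -- to `f 0`.
      · exact absurd (eq_of_adj_of_dist hT (hadj n).symm (hadj (n + 1)) (by omega) h) (hne n)
      · rw [h, h1]

theorem injective_of_nonbacktracking (hT : T.IsTree) (f : ℕ → V)
    (hadj : ∀ n, T.Adj (f n) (f (n + 1))) (hne : ∀ n, f n ≠ f (n + 2)) :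
    Function.Injective f := by
  have key : ∀ i k, f i = f (i + k) → k = 0 := by
    intro i k h
    have := dist_of_nonbacktracking hT (fun n => f (i + n)) (fun n => hadj (i + n))
      (fun n => hne (i + n)) k
    simpa [← h, eq_comm] using this
  intro a b h
  rcases le_total a b with hab | hab
  · obtain ⟨k, rfl⟩ := Nat.exists_eq_add_of_le hab
    simp [key a k h]
  · obtain ⟨k, rfl⟩ := Nat.exists_eq_add_of_le hab
    simp [key b k h.symm]

theorem Ray.ext' {a b : Ray T} (h : ∀ n, a.toFun n = b.toFun n) : a = b := by
  cases a; cases b; congr; exact funext h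

theorem Ray.dist_eq (hT : T.IsTree) (r : Ray T) (n : ℕ) : T.dist (r.toFun 0) (r.toFun n) = n :=
  dist_of_nonbacktracking hT _ r.adj (fun n h => by have := r.inj h; omega) n

theorem Ray.toEnd_eq_iff {a b : Ray T} :
    a.toEnd = b.toEnd ↔ ∃ m n : ℕ, ∀ k, a.toFun (m + k) = b.toFun (n + k) :=
  Quotient.eq (r := raySetoid (T := T))

theorem Ends.exists_ray (η : Ends T) : ∃ r : Ray T, r.toEnd = η := Quotient.exists_rep η

/-- Removing an initial segment of a ray. -/
def Ray.drop (r : Ray T) (m : ℕ) : Ray T where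
  toFun n := r.toFun (m + n)
  adj n := r.adj (m + n)
  inj a b h := by simpa using r.inj h

theorem Ray.drop_toEnd (r : Ray T) (m : ℕ) : (r.drop m).toEnd = r.toEnd :=
  Ray.toEnd_eq_iff.2 ⟨0, m, fun k => by simp [Ray.drop]⟩

theorem smul_toEnd (g : T ≃g T) (r : Ray T) : g • r.toEnd = (r.map g).toEnd := rfl

/-- In a tree, a ray is determined by its origin and its end. -/
theorem Ray.eq_of_toEnd_eq (hT : T.IsTree) {a b : Ray T} (h0 : a.toFun 0 = b.toFun 0)
    (h : a.toEnd = b.toEnd) : a = b := by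
  obtain ⟨m, n, hmn⟩ := Ray.toEnd_eq_iff.1 h
  have hk : ∀ k, a.toFun (m + k) = b.toFun (m + k) := by
    intro k
    have h1 := a.dist_eq hT (m + k)
    rw [h0, hmn k, b.dist_eq hT] at h1
    rw [hmn k, h1]
  -- Backward induction from the common tail: the predecessor is the unique neighbour nearer to the
  -- origin.
  have key : ∀ j i, i + j = m → a.toFun i = b.toFun i := by
    intro j
    induction j with
    | zero => intro i hi; simpa [← hi] using hk 0
    | succ j ih =>
      intro i hi
      have h1 := ih (i + 1) (by omega)
      refine eq_of_adj_of_dist hT (a := a.toFun 0) (a.adj i).symm (h1 ▸ (b.adj i).symm) ?_ ?_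
      · rw [a.dist_eq hT, a.dist_eq hT]
      · rw [a.dist_eq hT, h0, b.dist_eq hT]
  refine Ray.ext' fun i => ?_
  rcases le_total i m with hi | hi
  · exact key (m - i) i (by omega)
  · obtain ⟨k, rfl⟩ := Nat.exists_eq_add_of_le hi
    exact hk k

/-- Adding a vertex at the start of a ray. -/
theorem Ray.exists_cons (hT : T.IsTree) (r : Ray T) {w : V} (hw : T.Adj w (r.toFun 0))
    (h1 : r.toFun 1 ≠ w) :
    ∃ r' : Ray T, r'.toEnd = r.toEnd ∧ r'.toFun 0 = w ∧ ∀ n, r'.toFun (n + 1) = r.toFun n := by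
  let f : ℕ → V := fun n => Nat.casesOn n w r.toFun
  have hadj : ∀ n, T.Adj (f n) (f (n + 1)) := by
    rintro (_ | n)
    · exact hw
    · exact r.adj n
  refine ⟨⟨f, hadj, injective_of_nonbacktracking hT f hadj ?_⟩, ?_, rfl, fun _ => rfl⟩
  · rintro (_ | n)
    · exact h1.symm
    · exact fun h => by have := r.inj h; omega
  · exact Ray.toEnd_eq_iff.2 ⟨1, 0, fun k => by simp [f, add_comm 1 k]⟩

/-- Follow a walk to the origin of some ray for `ξ`, adjusting one edge at a time: the new vertex is
either already the second vertex of the ray, whose first vertex is then dropped, or can be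
prepended. -/
theorem exists_ray_from (hT : T.IsTree) (ξ : Ends T) (v : V) :
    ∃ r : Ray T, r.toEnd = ξ ∧ r.toFun 0 = v := by
  obtain ⟨r, rfl⟩ := ξ.exists_ray
  obtain ⟨p⟩ := hT.connected v (r.toFun 0)
  generalize hz : r.toFun 0 = z at p
  have : ∀ (v z : V) (p : T.Walk v z), r.toFun 0 = z →
      ∃ r' : Ray T, r'.toEnd = r.toEnd ∧ r'.toFun 0 = v := by
    intro v z p
    induction p with
    | nil => exact fun h => ⟨r, rfl, h⟩
    | @cons u w z huw p ih =>
      intro h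
      obtain ⟨r', hr', h0⟩ := ih h
      by_cases h1 : r'.toFun 1 = u
      · exact ⟨r'.drop 1, (r'.drop_toEnd 1).trans hr', h1⟩
      · obtain ⟨r'', h2, h3, -⟩ := r'.exists_cons hT (w := u) (h0 ▸ huw) h1
        exact ⟨r'', h2.trans hr', h3⟩
  exact this v z p hz

end Rays

/-! ### The orientation of the tree towards `ξ`, heights and horospheres. -/

section Parent

variable (hT : T.IsTree) (ξ : Ends T)

/-- The ray from `v` to the end `ξ`. -/
noncomputable def rayTo (v : V) : Ray T := (exists_ray_from hT ξ v).choose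

/-- The neighbour of `v` in the direction of the end `ξ`. -/
noncomputable def parent (v : V) : V := (rayTo hT ξ v).toFun 1

theorem rayTo_toEnd (v : V) : (rayTo hT ξ v).toEnd = ξ := (exists_ray_from hT ξ v).choose_spec.1

theorem rayTo_zero (v : V) : (rayTo hT ξ v).toFun 0 = v := (exists_ray_from hT ξ v).choose_spec.2

variable {ξ}

theorem eq_rayTo {r : Ray T} (hr : r.toEnd = ξ) : r = rayTo hT ξ (r.toFun 0) :=
  Ray.eq_of_toEnd_eq hT (rayTo_zero hT ξ _).symm (hr.trans (rayTo_toEnd hT ξ _).symm)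

theorem Ray.parent_eq {r : Ray T} (hr : r.toEnd = ξ) (n : ℕ) :
    parent hT ξ (r.toFun n) = r.toFun (n + 1) := by
  have := eq_rayTo hT (r := r.drop n) ((r.drop_toEnd n).trans hr)
  have h0 : (r.drop n).toFun 0 = r.toFun n := rfl
  rw [h0] at this
  rw [parent, ← this]
  rfl

theorem Ray.iterate_parent {r : Ray T} (hr : r.toEnd = ξ) (n : ℕ) :
    (parent hT ξ)^[n] (r.toFun 0) = r.toFun n := by
  induction n with
  | zero => rfl
  | succ n ih => rw [Function.iterate_succ_apply', ih, Ray.parent_eq hT hr]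

theorem iterate_parent_eq (v : V) (n : ℕ) :
    (parent hT ξ)^[n] v = (rayTo hT ξ v).toFun n := by
  rw [← Ray.iterate_parent hT (rayTo_toEnd hT ξ v), rayTo_zero]

theorem adj_parent (v : V) : T.Adj v (parent hT ξ v) := by
  have := (rayTo hT ξ v).adj 0
  rwa [rayTo_zero] at this

theorem iterate_parent_injective (v : V) :
    Function.Injective fun n => (parent hT ξ)^[n] v := by
  simp only [iterate_parent_eq]
  exact (rayTo hT ξ v).inj

theorem dist_iterate_parent (v : V) (n : ℕ) : T.dist v ((parent hT ξ)^[n] v) = n := by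
  have := (rayTo hT ξ v).dist_eq hT n
  rwa [rayTo_zero, ← iterate_parent_eq] at this

variable (ξ) in
-- If the ray from `u` to `ξ` avoids `w` at its first step, prepending `w` to it gives the ray from
-- `w`.
theorem parent_or_of_adj {u w : V} (h : T.Adj u w) :
    parent hT ξ u = w ∨ parent hT ξ w = u := by
  by_contra! hc
  obtain ⟨r, hr, h0, h1⟩ := (rayTo hT ξ u).exists_cons hT (w := w)
    (by rw [rayTo_zero]; exact h.symm) hc.1
  rw [rayTo_toEnd] at hr
  have := Ray.parent_eq hT hr 0
  rw [h0, h1 0, rayTo_zero] at this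
  exact hc.2 this

variable (ξ) in
theorem exists_common_ancestor (u w : V) :
    ∃ m n : ℕ, (parent hT ξ)^[m] u = (parent hT ξ)^[n] w := by
  have h : (rayTo hT ξ u).toEnd = (rayTo hT ξ w).toEnd := by simp only [rayTo_toEnd]
  obtain ⟨m, n, h⟩ := Ray.toEnd_eq_iff.1 h
  exact ⟨m, n, by simpa [iterate_parent_eq] using h 0⟩

theorem map_parent {g : T ≃g T} (hg : g • ξ = ξ) (v : V) :
    g (parent hT ξ v) = parent hT ξ (g v) := by
  have h : ((rayTo hT ξ v).map g).toEnd = ξ := by rw [← smul_toEnd, rayTo_toEnd, hg]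
  have := Ray.parent_eq hT h 0
  simp only [Ray.map, rayTo_zero] at this
  rw [this]; rfl

theorem map_iterate_parent {g : T ≃g T} (hg : g • ξ = ξ) (n : ℕ) (v : V) :
    g ((parent hT ξ)^[n] v) = (parent hT ξ)^[n] (g v) := by
  induction n generalizing v with
  | zero => rfl
  | succ n ih => rw [Function.iterate_succ_apply, ih, map_parent hT hg,
      ← Function.iterate_succ_apply]

variable (ξ) in
theorem exists_height : ∃ h : V → ℤ, ∀ v, h (parent hT ξ v) = h v + 1 := by
  obtain ⟨o⟩ := hT.connected.nonempty
  choose m n hmn using fun v => exists_common_ancestor hT ξ v o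
  -- With `m v` steps up from `v` meeting `n v` steps up from `o`, the difference does not depend on
  -- the chosen meeting point.
  refine ⟨fun v => n v - m v, fun v => ?_⟩
  have h1 : (parent hT ξ)^[m (parent hT ξ v) + 1 + m v] v =
      (parent hT ξ)^[n (parent hT ξ v) + m v] o := by
    rw [add_comm _ (m v), Function.iterate_add_apply, Function.iterate_succ_apply, hmn,
      ← Function.iterate_add_apply, add_comm]
  have h2 : (parent hT ξ)^[m (parent hT ξ v) + 1 + m v] v =
      (parent hT ξ)^[m (parent hT ξ v) + 1 + n v] o := by
    rw [Function.iterate_add_apply, hmn, ← Function.iterate_add_apply]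
  have := iterate_parent_injective hT o (h1.symm.trans h2)
  simp only
  omega

variable (ξ) in
/-- A height function on the vertices, increasing by one at each step towards the end `ξ`. -/
noncomputable def height (v : V) : ℤ := (exists_height hT ξ).choose v

theorem height_parent (v : V) : height hT ξ (parent hT ξ v) = height hT ξ v + 1 :=
  (exists_height hT ξ).choose_spec v

theorem height_iterate (v : V) (n : ℕ) :
    height hT ξ ((parent hT ξ)^[n] v) = height hT ξ v + n := by
  induction n with
  | zero => simp
  | succ n ih => rw [Function.iterate_succ_apply', height_parent, ih]; push_cast; ring

theorem abs_height_sub_le_length {u w : V} (p : T.Walk u w) :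
    |height hT ξ u - height hT ξ w| ≤ p.length := by
  induction p with
  | nil => simp
  | @cons u v w h p ih =>
    have : |height hT ξ u - height hT ξ v| ≤ 1 := by
      rcases parent_or_of_adj hT ξ h with rfl | rfl <;> simp [height_parent]
    rw [SimpleGraph.Walk.length_cons]
    have h2 := abs_sub_le (height hT ξ u) (height hT ξ v) (height hT ξ w)
    push_cast
    linarith

theorem abs_height_sub_le_dist (u w : V) :
    |height hT ξ u - height hT ξ w| ≤ T.dist u w := by
  obtain ⟨p, hp⟩ := hT.connected.exists_walk_length_eq_dist u w
  rw [← hp]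
  exact abs_height_sub_le_length hT p

/-- Far enough in the direction of `ξ`, the ancestors of two vertices agree. -/
theorem exists_common_ancestor_of_le (u w : V) :
    ∃ N : ℤ, ∀ m n : ℕ, N ≤ height hT ξ u + m → height hT ξ u + m = height hT ξ w + n →
      (parent hT ξ)^[m] u = (parent hT ξ)^[n] w := by
  obtain ⟨i, j, hij⟩ := exists_common_ancestor hT ξ u w
  have h0 := congrArg (height hT ξ) hij
  rw [height_iterate, height_iterate] at h0
  refine ⟨height hT ξ u + i, fun m n h1 h2 => ?_⟩
  obtain ⟨k, rfl⟩ := Nat.exists_eq_add_of_le (show i ≤ m by omega)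
  have : n = j + k := by push_cast at h2; omega
  rw [this, add_comm i, add_comm j, Function.iterate_add_apply, hij, ← Function.iterate_add_apply]

theorem height_map_sub {g : T ≃g T} (hg : g • ξ = ξ) (u w : V) :
    height hT ξ (g u) - height hT ξ u = height hT ξ (g w) - height hT ξ w := by
  obtain ⟨i, j, hij⟩ := exists_common_ancestor hT ξ u w
  have h0 := congrArg (height hT ξ) hij
  have h1 := congrArg (fun v => height hT ξ (g v)) hij
  simp only [map_iterate_parent hT hg, height_iterate] at h0 h1
  omega

/-- Far along a ray to `ξ` the vertices are ancestors of `v`, so their distance to `v` is a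
difference of heights. -/
theorem mem_horosphere_iff {v w : V} :
    w ∈ horosphere ξ v ↔ height hT ξ v = height hT ξ w := by
  have key : ∀ x : Ray T, x.toEnd = ξ → ∀ v, ∀ᶠ n in atTop,
      (T.dist v (x.toFun n) : ℤ) = height hT ξ (x.toFun n) - height hT ξ v := by
    intro x hx v
    obtain ⟨i, j, hij⟩ := exists_common_ancestor hT ξ v (x.toFun 0)
    filter_upwards [eventually_ge_atTop j] with n hn
    obtain ⟨k, rfl⟩ := Nat.exists_eq_add_of_le hn
    have : x.toFun (j + k) = (parent hT ξ)^[k + i] v := by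
      rw [Function.iterate_add_apply, hij, ← Function.iterate_add_apply, add_comm,
        Ray.iterate_parent hT hx]
    rw [this, dist_iterate_parent, height_iterate]
    ring
  constructor
  · rintro ⟨x, hx, h⟩
    obtain ⟨n, h1, h2, h3⟩ := (h.and ((key x hx v).and (key x hx w))).exists
    omega
  · intro h
    refine ⟨rayTo hT ξ v, rayTo_toEnd hT ξ v, ?_⟩
    filter_upwards [key _ (rayTo_toEnd hT ξ v) v, key _ (rayTo_toEnd hT ξ v) w] with n h2 h3
    omega

end Parent

/-! ### Branches, shadows, and the compact topology on the ends. -/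

section Branches

variable (hT : T.IsTree) (ξ : Ends T)

/-- `y` is the line from `η` to `ξ`, parametrized by height. -/
structure IsBranchOf (y : ℤ → V) (η : Ends T) : Prop where
  parent_eq : ∀ n, parent hT ξ (y n) = y (n + 1)
  height_eq : ∀ n, height hT ξ (y n) = n
  exists_ray : ∃ r : Ray T, r.toEnd = η ∧ ∀ n : ℕ, r.toFun n = y (-n)

/-- The ends `η ≠ ξ` such that the line from `η` to `ξ` passes through `v`. -/
def shadow (v : V) : Set (Ends T) :=
  {η | ∃ y, IsBranchOf hT ξ y η ∧ y (height hT ξ v) = v}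

variable {hT ξ}

theorem height_of_descending {x : ℕ → V} (hx : ∀ n, parent hT ξ (x (n + 1)) = x n) (n : ℕ) :
    height hT ξ (x n) = height hT ξ (x 0) - n := by
  induction n with
  | zero => simp
  | succ n ih =>
    have := height_parent (ξ := ξ) hT (x (n + 1))
    rw [hx, ih] at this
    push_cast
    omega

/-- The ray running away from `ξ` along a descending sequence. -/
def descendingRay (x : ℕ → V) (hx : ∀ n, parent hT ξ (x (n + 1)) = x n) : Ray T where
  toFun := x
  adj n := by
    have := adj_parent (ξ := ξ) hT (x (n + 1))
    rw [hx] at this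
    exact this.symm
  inj a b h := by
    have h1 := height_of_descending hx a
    have h2 := height_of_descending hx b
    rw [h] at h1
    omega

theorem toEnd_ne_of_descending {r : Ray T}
    (hr : ∀ n, parent hT ξ (r.toFun (n + 1)) = r.toFun n) : r.toEnd ≠ ξ := by
  intro h
  have h1 := Ray.parent_eq hT h 1
  rw [hr 0] at h1
  have := r.inj h1
  omega

/-- A ray that has turned away from `ξ` cannot turn back, since going up would mean returning to the
unique parent it came from. -/
theorem descending_of_one {r : Ray T} (h : parent hT ξ (r.toFun 1) = r.toFun 0) (n : ℕ) :
    parent hT ξ (r.toFun (n + 1)) = r.toFun n := by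
  induction n with
  | zero => exact h
  | succ n ih =>
    rcases parent_or_of_adj hT ξ (r.adj (n + 1)) with h1 | h1
    · rw [ih] at h1
      have := r.inj h1
      omega
    · exact h1

theorem exists_descending_ray {η : Ends T} (hη : η ≠ ξ) :
    ∃ r : Ray T, r.toEnd = η ∧ ∀ n, parent hT ξ (r.toFun (n + 1)) = r.toFun n := by
  obtain ⟨r, rfl⟩ := η.exists_ray
  have : ∃ N, parent hT ξ (r.toFun (N + 1)) = r.toFun N := by
    by_contra! hc
    refine hη ?_
    have h1 : ∀ n, parent hT ξ (r.toFun n) = r.toFun (n + 1) := fun n =>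
      (parent_or_of_adj hT ξ (r.adj n)).resolve_right (hc n)
    have h2 : ∀ n, (parent hT ξ)^[n] (r.toFun 0) = r.toFun n := by
      intro n
      induction n with
      | zero => rfl
      | succ n ih => rw [Function.iterate_succ_apply', ih, h1]
    rw [← rayTo_toEnd hT ξ (r.toFun 0)]
    exact Ray.toEnd_eq_iff.2 ⟨0, 0, fun k => by rw [← h2, iterate_parent_eq]⟩
  obtain ⟨N, hN⟩ := this
  exact ⟨r.drop N, r.drop_toEnd N, descending_of_one (r := r.drop N) hN⟩

theorem exists_branch_of_descending {r : Ray T}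
    (hr : ∀ n, parent hT ξ (r.toFun (n + 1)) = r.toFun n) :
    ∃ y, IsBranchOf hT ξ y r.toEnd ∧ ∀ n : ℕ, y (height hT ξ (r.toFun 0) - n) = r.toFun n := by
  set h0 := height hT ξ (r.toFun 0) with hh0
  let y : ℤ → V := fun k =>
    if k ≤ h0 then r.toFun (h0 - k).toNat else (parent hT ξ)^[(k - h0).toNat] (r.toFun 0)
  have hy : ∀ n : ℕ, y (h0 - n) = r.toFun n := fun n => by simp [y]
  have hy' : ∀ n : ℕ, y (h0 + n) = (parent hT ξ)^[n] (r.toFun 0) := fun n => by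
    rcases Nat.eq_zero_or_pos n with rfl | hn
    · simp [y]
    · have : ¬ h0 + n ≤ h0 := by omega
      simp [y, show n ≠ 0 by omega]
  have hcases : ∀ k : ℤ, (∃ n : ℕ, k = h0 + n) ∨ ∃ n : ℕ, k = h0 - (n + 1 : ℕ) := by
    intro k
    rcases le_or_gt h0 k with h | h
    · exact Or.inl ⟨(k - h0).toNat, by omega⟩
    · exact Or.inr ⟨(h0 - k).toNat - 1, by omega⟩
  have hp : ∀ n, parent hT ξ (y n) = y (n + 1) := by
    intro k
    rcases hcases k with ⟨n, rfl⟩ | ⟨n, rfl⟩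
    · rw [hy', ← Function.iterate_succ_apply' (parent hT ξ), ← hy']
      push_cast; rw [add_assoc]
    · rw [hy, hr, ← hy]
      congr 1; push_cast; ring
  have hh : ∀ n, height hT ξ (y n) = n := by
    intro k
    rcases hcases k with ⟨n, rfl⟩ | ⟨n, rfl⟩
    · rw [hy', height_iterate]
    · rw [hy, height_of_descending hr]
  refine ⟨y, ⟨hp, hh, ?_⟩, hy⟩
  refine ⟨descendingRay (hT := hT) (ξ := ξ) (fun n : ℕ => y (-n)) ?_, ?_, fun n => rfl⟩
  · intro n
    rw [hp]; congr 1; push_cast; ring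
  -- The two rays start at heights `0` and `h0`; the truncations cut both down to height `min 0 h0`.
  · refine Ray.toEnd_eq_iff.2 ⟨(-h0).toNat, h0.toNat, fun k => ?_⟩
    rw [← hy]
    simp only [descendingRay]
    congr 1
    omega

theorem exists_branch {η : Ends T} (hη : η ≠ ξ) : ∃ y, IsBranchOf hT ξ y η := by
  obtain ⟨r, rfl, hr⟩ := exists_descending_ray (hT := hT) hη
  obtain ⟨y, hy, -⟩ := exists_branch_of_descending hr
  exact ⟨y, hy⟩

namespace IsBranchOf

variable {y y' : ℤ → V} {η η' : Ends T}

theorem of_parent_eq (hp : ∀ n, parent hT ξ (y n) = y (n + 1))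
    (hh : ∀ n, height hT ξ (y n) = n) : ∃ η, IsBranchOf hT ξ y η := by
  refine ⟨_, hp, hh, descendingRay (hT := hT) (ξ := ξ) (fun n : ℕ => y (-n)) ?_, rfl,
    fun n => rfl⟩
  intro n
  rw [hp]; congr 1; push_cast; ring

theorem iterate (h : IsBranchOf hT ξ y η) (n : ℤ) (k : ℕ) :
    (parent hT ξ)^[k] (y n) = y (n + k) := by
  induction k with
  | zero => simp
  | succ k ih => rw [Function.iterate_succ_apply', ih, h.parent_eq]; push_cast; rw [add_assoc]

theorem ne (h : IsBranchOf hT ξ y η) : η ≠ ξ := by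
  obtain ⟨r, rfl, hr⟩ := h.exists_ray
  refine toEnd_ne_of_descending (hT := hT) fun n => ?_
  rw [hr, hr, h.parent_eq]; congr 1; push_cast; ring

/-- The ray along a branch, starting at height `m` and running away from `ξ`. -/
theorem exists_ray_from (h : IsBranchOf hT ξ y η) (m : ℤ) :
    ∃ r : Ray T, r.toEnd = η ∧ ∀ n : ℕ, r.toFun n = y (m - n) := by
  obtain ⟨r, rfl, hr⟩ := h.exists_ray
  refine ⟨descendingRay (hT := hT) (ξ := ξ) (fun n : ℕ => y (m - n)) ?_, ?_, fun n => rfl⟩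
  · intro n
    rw [h.parent_eq]; congr 1; push_cast; ring
  · refine Ray.toEnd_eq_iff.2 ⟨m.toNat, (-m).toNat, fun k => ?_⟩
    rw [hr]
    simp only [descendingRay]
    congr 1
    omega

theorem eq_of_eq_of_le (h : IsBranchOf hT ξ y η) (h' : IsBranchOf hT ξ y' η') {m n : ℤ}
    (hm : y m = y' m) (hmn : m ≤ n) : y n = y' n := by
  obtain ⟨k, rfl⟩ := Int.exists_add_of_le hmn
  rw [← h.iterate, hm, h'.iterate]

/-- Cofinal rays give common vertices arbitrarily far down, and agreement at one height propagates
upwards through `parent`. -/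
theorem unique (h : IsBranchOf hT ξ y η) (h' : IsBranchOf hT ξ y' η) : y = y' := by
  obtain ⟨r, hr, hry⟩ := h.exists_ray
  obtain ⟨r', hr', hry'⟩ := h'.exists_ray
  obtain ⟨i, j, hij⟩ := Ray.toEnd_eq_iff.1 (hr.trans hr'.symm)
  have h1 : ∀ k : ℕ, y (-(i + k : ℕ)) = y' (-(i + k : ℕ)) := by
    intro k
    have h2 := hij k
    rw [hry, hry'] at h2
    have h3 := congrArg (height hT ξ) h2
    rw [h.height_eq, h'.height_eq] at h3
    rw [h2, h3]
  funext n
  exact h.eq_of_eq_of_le h' (h1 n.natAbs) (by omega)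

theorem end_unique (h : IsBranchOf hT ξ y η) (h' : IsBranchOf hT ξ y η') : η = η' := by
  obtain ⟨r, rfl, hry⟩ := h.exists_ray
  obtain ⟨r', rfl, hry'⟩ := h'.exists_ray
  exact Ray.toEnd_eq_iff.2 ⟨0, 0, fun k => by rw [hry, hry']⟩

theorem mem_shadow (h : IsBranchOf hT ξ y η) {v : V} :
    η ∈ shadow hT ξ v ↔ y (height hT ξ v) = v :=
  ⟨fun ⟨_, hy', hv⟩ => h.unique hy' ▸ hv, fun hv => ⟨y, h, hv⟩⟩

theorem mem_shadow_self (h : IsBranchOf hT ξ y η) (n : ℤ) : η ∈ shadow hT ξ (y n) :=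
  h.mem_shadow.2 (by rw [h.height_eq])

theorem smul (h : IsBranchOf hT ξ y η) {g : T ≃g T} (hg : g • ξ = ξ) {c : ℤ}
    (hc : ∀ v, height hT ξ (g v) = height hT ξ v + c) :
    IsBranchOf hT ξ (fun n => g (y (n - c))) (g • η) := by
  refine ⟨fun n => ?_, fun n => ?_, ?_⟩
  · rw [← map_parent hT hg, h.parent_eq]; congr 2; ring
  · rw [hc, h.height_eq]; ring
  · obtain ⟨r, hr, hry⟩ := h.exists_ray_from (-c)
    refine ⟨r.map g, by rw [← hr]; rfl, fun n => ?_⟩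
    simp only [Ray.map, hry]
    congr 2; ring

/-- The line between the two ends of a branch. -/
def line (h : IsBranchOf hT ξ y η) : Line T where
  toFun := y
  adj n := by
    have := adj_parent (ξ := ξ) hT (y n)
    rwa [h.parent_eq] at this
  inj a b hab := by
    have := congrArg (height hT ξ) hab
    rwa [h.height_eq, h.height_eq] at this

theorem line_negEnd (h : IsBranchOf hT ξ y η) : h.line.negEnd = η := by
  obtain ⟨r, hr, hry⟩ := h.exists_ray
  refine Eq.trans ?_ hr
  exact Ray.toEnd_eq_iff.2 ⟨0, 0, fun k => by rw [hry]; rfl⟩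

theorem line_posEnd (h : IsBranchOf hT ξ y η) : h.line.posEnd = ξ := by
  refine Eq.trans ?_ (rayTo_toEnd hT ξ (y 0))
  refine Ray.toEnd_eq_iff.2 ⟨0, 0, fun k => ?_⟩
  rw [← iterate_parent_eq, h.iterate, zero_add, zero_add]
  rfl

theorem exists_eq_of_line (h : IsBranchOf hT ξ y η) {L : Line T} (hneg : L.negEnd = η)
    (hpos : L.posEnd = ξ) : ∃ c : ℤ, ∀ n, L.toFun n = y (n + c) := by
  have hp : ∀ n, parent hT ξ (L.toFun n) = L.toFun (n + 1) := by
    intro n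
    let r : Ray T :=
      { toFun := fun k => L.toFun (n + k)
        adj := fun k => by have := L.adj (n + k); rwa [add_assoc] at this
        inj := fun a b hab => by simpa using L.inj hab }
    have hr : r.toEnd = ξ := by
      rw [← hpos]
      refine Ray.toEnd_eq_iff.2 ⟨(-n).toNat, n.toNat, fun k => ?_⟩
      simp only [r]
      congr 1; omega
    have := Ray.parent_eq hT hr 0
    simpa [r] using this
  set c := height hT ξ (L.toFun 0) with hc
  have hnat : ∀ (m : ℤ) (k : ℕ),
      height hT ξ (L.toFun (m + k)) = height hT ξ (L.toFun m) + k := by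
    intro m k
    induction k with
    | zero => simp
    | succ k ih =>
      rw [show m + ((k + 1 : ℕ) : ℤ) = (m + k) + 1 by push_cast; ring, ← hp, height_parent, ih]
      push_cast; ring
  have hh : ∀ n, height hT ξ (L.toFun n) = n + c := by
    intro n
    rcases le_total 0 n with hn | hn
    · obtain ⟨k, hk⟩ := Int.exists_add_of_le hn
      rw [hk, hnat]; simp [hc]; ring
    · obtain ⟨k, hk⟩ := Int.exists_add_of_le hn
      have := hnat n k
      rw [← hk, ← hc] at this
      omega
  have hL : IsBranchOf hT ξ (fun n => L.toFun (n - c)) η := by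
    refine ⟨fun n => by rw [hp]; congr 1; ring, fun n => by rw [hh]; ring, ?_⟩
    let r : Ray T :=
      { toFun := fun k => L.toFun (-k - c)
        adj := fun k => by
          have := (L.adj (-k - c - 1)).symm
          rw [sub_add_cancel] at this
          convert this using 2
          push_cast; ring
        inj := fun a b hab => by simpa using L.inj hab }
    refine ⟨r, ?_, fun n => rfl⟩
    rw [← hneg]
    refine Ray.toEnd_eq_iff.2 ⟨(-c).toNat, c.toNat, fun k => ?_⟩
    simp only [r]
    congr 1; omega
  refine ⟨c, fun n => ?_⟩
  rw [h.unique hL]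
  simp

theorem lineBetween_eq (h : IsBranchOf hT ξ y η) : lineBetween ξ η = range y := by
  ext v
  constructor
  · rintro ⟨L, hneg, hpos, n, rfl⟩
    obtain ⟨c, hc⟩ := h.exists_eq_of_line hneg hpos
    exact ⟨n + c, (hc n).symm⟩
  · rintro ⟨n, rfl⟩
    exact ⟨h.line, h.line_negEnd, h.line_posEnd, n, rfl⟩

end IsBranchOf

theorem not_mem_shadow_end (v : V) : ξ ∉ shadow hT ξ v := fun ⟨_, hy, _⟩ => hy.ne rfl

theorem shadow_subset_parent (v : V) : shadow hT ξ v ⊆ shadow hT ξ (parent hT ξ v) := by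
  rintro η ⟨y, hy, hv⟩
  refine ⟨y, hy, ?_⟩
  rw [height_parent, ← hy.parent_eq, hv]

theorem shadow_subset_iterate (v : V) (n : ℕ) :
    shadow hT ξ v ⊆ shadow hT ξ ((parent hT ξ)^[n] v) := by
  induction n with
  | zero => exact subset_rfl
  | succ n ih => rw [Function.iterate_succ_apply']; exact ih.trans (shadow_subset_parent _)

theorem IsBranchOf.shadow_mono {y : ℤ → V} {η : Ends T} (h : IsBranchOf hT ξ y η) :
    Monotone fun n => shadow hT ξ (y n) := by
  intro m n hmn
  obtain ⟨k, rfl⟩ := Int.exists_add_of_le hmn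
  simp only [← h.iterate]
  exact shadow_subset_iterate _ _

theorem shadow_eq_iUnion (v : V) :
    shadow hT ξ v = ⋃ w ∈ {w | parent hT ξ w = v}, shadow hT ξ w := by
  ext η
  simp only [mem_ofPred_eq, mem_iUnion, exists_prop]
  constructor
  · rintro ⟨y, hy, hv⟩
    refine ⟨y (height hT ξ v - 1), ?_, hy.mem_shadow_self _⟩
    rw [hy.parent_eq, sub_add_cancel, hv]
  · rintro ⟨w, rfl, hw⟩
    exact shadow_subset_parent w hw

theorem eq_of_mem_shadow {η : Ends T} {v w : V} (hv : η ∈ shadow hT ξ v)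
    (hw : η ∈ shadow hT ξ w) (h : height hT ξ v = height hT ξ w) : v = w := by
  obtain ⟨y, hy, hyv⟩ := hv
  rw [hy.mem_shadow, ← h, hyv] at hw
  exact hw

theorem smul_mem_shadow {g : T ≃g T} (hg : g • ξ = ξ) {η : Ends T} {v : V}
    (h : η ∈ shadow hT ξ v) : g • η ∈ shadow hT ξ (g v) := by
  obtain ⟨y, hy, hv⟩ := h
  have hc : ∀ w, height hT ξ (g w) =
      height hT ξ w + (height hT ξ (g v) - height hT ξ v) := by
    intro w
    have := height_map_sub hT hg v w
    omega
  refine ⟨_, hy.smul hg hc, ?_⟩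
  simp [hv]

theorem smul_mem_shadow_iff {g : T ≃g T} (hg : g • ξ = ξ) {η : Ends T} {v : V} :
    g • η ∈ shadow hT ξ (g v) ↔ η ∈ shadow hT ξ v := by
  refine ⟨fun h => ?_, smul_mem_shadow hg⟩
  have := smul_mem_shadow (g := g⁻¹) (by rw [inv_smul_eq_iff, hg]) h
  rw [inv_smul_smul] at this
  convert this
  exact (g.symm_apply_apply v).symm

/-- Without children, the parent would be the only neighbour. -/
theorem exists_child (hleaf : Leafless T) (v : V) : ∃ w, parent hT ξ w = v := by
  by_contra! hc
  refine hleaf v ⟨parent hT ξ v, adj_parent hT v, fun w hw => ?_⟩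
  exact ((parent_or_of_adj hT ξ hw).resolve_right (hc w)).symm

theorem shadow_nonempty (hleaf : Leafless T) (v : V) : (shadow hT ξ v).Nonempty := by
  choose c hc using exists_child (hT := hT) (ξ := ξ) hleaf
  obtain ⟨y, hy, hyv⟩ := exists_branch_of_descending (r := descendingRay (hT := hT) (ξ := ξ)
    (fun n => c^[n] v) fun n => by rw [Function.iterate_succ_apply', hc]) fun n => by
      simp only [descendingRay]; rw [Function.iterate_succ_apply', hc]
  refine ⟨_, y, hy, ?_⟩
  simpa [descendingRay] using hyv 0

theorem mem_shadow_iff_exists_ray {u w : V} (hp : parent hT ξ w = u) {η : Ends T} :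
    η ∈ shadow hT ξ w ↔ ∃ r : Ray T, r.toFun 0 = u ∧ r.toFun 1 = w ∧ r.toEnd = η := by
  constructor
  · rintro ⟨y, hy, hw⟩
    obtain ⟨r, hr, hry⟩ := hy.exists_ray_from (height hT ξ u)
    refine ⟨r, ?_, ?_, hr⟩
    · rw [hry, ← hp, height_parent, Nat.cast_zero, sub_zero, ← hy.parent_eq, hw]
    · rw [hry, ← hp, height_parent, Nat.cast_one, add_sub_cancel_right, hw]
  · rintro ⟨r, h0, h1, rfl⟩
    obtain ⟨y, hy, hyr⟩ := exists_branch_of_descending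
      (descending_of_one (r := r) (hT := hT) (ξ := ξ) (by rw [h0, h1, hp]))
    refine ⟨y, hy, ?_⟩
    have := hyr 1
    rwa [h0, h1, ← hp, height_parent, Nat.cast_one, add_sub_cancel_right] at this

/-- A ray leaving `u` goes to a child, and then its end lies in the shadow of `u`, or to the parent.
-/
theorem compl_shadow_eq_of_parent {u w : V} (hp : parent hT ξ u = w) :
    (shadow hT ξ u)ᶜ = {η | ∃ r : Ray T, r.toFun 0 = u ∧ r.toFun 1 = w ∧ r.toEnd = η} := by
  ext η
  constructor
  · intro hη
    obtain ⟨r, rfl, h0⟩ := TreeEnds.exists_ray_from hT η u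
    refine ⟨r, h0, ?_, rfl⟩
    have hadj := r.adj 0
    rw [h0] at hadj
    rcases parent_or_of_adj hT ξ hadj with h | h
    · exact h.symm.trans hp
    · exact absurd (h ▸ shadow_subset_parent _ ((mem_shadow_iff_exists_ray h).2 ⟨r, h0, rfl, rfl⟩))
        hη
  · rintro ⟨r, h0, h1, rfl⟩ ⟨y, hy, hyu⟩
    obtain ⟨r', hr', hry⟩ := hy.exists_ray_from (height hT ξ u)
    have : r' = r := Ray.eq_of_toEnd_eq hT (by rw [hry, h0]; simpa using hyu) hr'
    subst this
    have h2 := congrArg (height hT ξ) h1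
    rw [hry, hy.height_eq, ← hp, height_parent] at h2
    omega

variable (hT ξ) in
theorem ends_topology_eq : instTopologicalSpaceEnds (T := T) =
    TopologicalSpace.generateFrom
      {A | ∃ v : V, A = shadow hT ξ v ∨ A = (shadow hT ξ v)ᶜ} := by
  unfold instTopologicalSpaceEnds
  congr 1
  ext A
  constructor
  · rintro ⟨u, w, hadj, rfl⟩
    rcases parent_or_of_adj hT ξ hadj with h | h
    · exact ⟨u, Or.inr (compl_shadow_eq_of_parent h).symm⟩
    · exact ⟨w, Or.inl (ext fun η => (mem_shadow_iff_exists_ray h).symm)⟩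
  · rintro ⟨v, rfl | rfl⟩
    · exact ⟨_, v, (adj_parent hT v).symm, ext fun η => mem_shadow_iff_exists_ray rfl⟩
    · exact ⟨v, _, adj_parent hT v, compl_shadow_eq_of_parent rfl⟩

theorem isClopen_shadow (v : V) : IsClopen (shadow hT ξ v) := by
  constructor
  · rw [← isOpen_compl_iff, ends_topology_eq hT ξ]
    exact TopologicalSpace.isOpen_generateFrom_of_mem ⟨v, Or.inr rfl⟩
  · rw [ends_topology_eq hT ξ]
    exact TopologicalSpace.isOpen_generateFrom_of_mem ⟨v, Or.inl rfl⟩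

/-- Shadows along the branch form a neighbourhood base at `η`. A complement of a shadow not
containing `η` is handled by disjointness of shadows of distinct vertices at equal height. -/
theorem exists_shadow_subset {y : ℤ → V} {η : Ends T} (hy : IsBranchOf hT ξ y η)
    {U : Set (Ends T)} (hU : IsOpen U) (hη : η ∈ U) : ∃ m, shadow hT ξ (y m) ⊆ U := by
  rw [ends_topology_eq hT ξ] at hU
  induction hU with
  | basic s hs =>
    obtain ⟨v, rfl | rfl⟩ := hs
    · exact ⟨height hT ξ v, by rw [hy.mem_shadow.1 hη]⟩
    · refine ⟨height hT ξ v, fun η' h1 h2 => hη (hy.mem_shadow.2 ?_)⟩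
      exact eq_of_mem_shadow h1 h2 (hy.height_eq _)
  | univ => exact ⟨0, subset_univ _⟩
  | inter s t _ _ ihs iht =>
    obtain ⟨m, hm⟩ := ihs hη.1
    obtain ⟨n, hn⟩ := iht hη.2
    exact ⟨min m n, subset_inter ((hy.shadow_mono (min_le_left m n)).trans hm)
      ((hy.shadow_mono (min_le_right m n)).trans hn)⟩
  | sUnion S _ ih =>
    obtain ⟨s, hs, hηs⟩ := hη
    obtain ⟨m, hm⟩ := ih s hs hηs
    exact ⟨m, hm.trans (subset_sUnion_of_mem hs)⟩

variable (hT ξ) in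
-- Complements of shadows form a neighbourhood base at `ξ`; for intersections, a common ancestor has
-- a shadow containing both given ones.
theorem exists_compl_shadow_subset {U : Set (Ends T)} (hU : IsOpen U) (hξ : ξ ∈ U) :
    ∃ w, (shadow hT ξ w)ᶜ ⊆ U := by
  rw [ends_topology_eq hT ξ] at hU
  induction hU with
  | basic s hs =>
    obtain ⟨v, rfl | rfl⟩ := hs
    · exact absurd hξ (not_mem_shadow_end v)
    · exact ⟨v, subset_rfl⟩
  | univ => exact ⟨hT.connected.nonempty.some, subset_univ _⟩
  | inter s t _ _ ihs iht =>
    obtain ⟨u, hu⟩ := ihs hξ.1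
    obtain ⟨w, hw⟩ := iht hξ.2
    obtain ⟨m, n, hmn⟩ := exists_common_ancestor hT ξ u w
    refine ⟨(parent hT ξ)^[m] u, subset_inter ?_ ?_⟩
    · exact (compl_subset_compl.2 (shadow_subset_iterate u m)).trans hu
    · rw [hmn]
      exact (compl_subset_compl.2 (shadow_subset_iterate w n)).trans hw
  | sUnion S _ ih =>
    obtain ⟨s, hs, hηs⟩ := hξ
    obtain ⟨m, hm⟩ := ih s hs hηs
    exact ⟨m, hm.trans (subset_sUnion_of_mem hs)⟩

theorem isOpen_singleton_end_iff :
    IsOpen ({ξ} : Set (Ends T)) ↔ ∃ w, ∀ η, η ≠ ξ → η ∈ shadow hT ξ w := by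
  constructor
  · intro h
    obtain ⟨w, hw⟩ := exists_compl_shadow_subset hT ξ h rfl
    exact ⟨w, fun η hη => by_contra fun h => hη (hw h)⟩
  · rintro ⟨w, hw⟩
    have : ({ξ} : Set (Ends T)) = (shadow hT ξ w)ᶜ := by
      ext η
      constructor
      · rintro rfl
        exact not_mem_shadow_end w
      · exact fun h => by_contra fun hne => h (hw η hne)
    rw [this]
    exact (isClopen_shadow w).compl.isOpen

variable (hT ξ) in
theorem exists_shadow_separating {η η' : Ends T} (h : η ≠ η') :
    ∃ v, ¬ (η ∈ shadow hT ξ v ↔ η' ∈ shadow hT ξ v) := by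
  wlog hη : η ≠ ξ generalizing η η'
  · obtain ⟨v, hv⟩ := this h.symm (fun h' => h ((not_not.1 hη).trans h'.symm))
    exact ⟨v, fun h => hv h.symm⟩
  by_contra! hc
  obtain ⟨y, hy⟩ := exists_branch (hT := hT) hη
  have hη' : η' ≠ ξ := by
    rintro rfl
    exact not_mem_shadow_end _ ((hc (y 0)).1 (hy.mem_shadow_self 0))
  obtain ⟨y', hy'⟩ := exists_branch (hT := hT) hη'
  refine h ?_
  have : y' = y := by
    funext n
    have := hy'.mem_shadow.1 ((hc (y n)).1 (hy.mem_shadow_self n))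
    rwa [hy.height_eq] at this
  subst this
  exact hy.end_unique hy'

/-- An ultrafilter containing no shadow converges to `ξ`. If it contains one, finiteness of the set
of children lets it choose a child's shadow repeatedly, as in König's lemma, and it converges to the
end so traced. -/
theorem compactSpace_ends (hT : T.IsTree) (ξ : Ends T)
    (hfin : ∀ v : V, (T.neighborSet v).Finite) :
    CompactSpace (Ends T) := by
  refine ⟨isCompact_iff_ultrafilter_le_nhds.2 fun F _ => ?_⟩
  by_cases hF : ∀ v, shadow hT ξ v ∉ F
  · refine ⟨ξ, mem_univ _, fun U hU => ?_⟩
    obtain ⟨W, hWU, hW, hξ⟩ := mem_nhds_iff.1 hU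
    obtain ⟨w, hw⟩ := exists_compl_shadow_subset hT ξ hW hξ
    exact mem_of_superset (Ultrafilter.compl_mem_iff_notMem.2 (hF w)) (hw.trans hWU)
  push Not at hF
  obtain ⟨v₀, hv₀⟩ := hF
  have hchild : ∀ v : {v // shadow hT ξ v ∈ F}, ∃ w : {v // shadow hT ξ v ∈ F},
      parent hT ξ w.1 = v.1 := by
    rintro ⟨v, hv⟩
    have hf : {w | parent hT ξ w = v}.Finite := (hfin v).subset fun w hw => by
      rw [← show parent hT ξ w = v from hw]
      exact (adj_parent hT w).symm
    rw [shadow_eq_iUnion, Ultrafilter.finite_biUnion_mem_iff hf] at hv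
    obtain ⟨w, hw, hwF⟩ := hv
    exact ⟨⟨w, hwF⟩, hw⟩
  choose c hc using hchild
  let x : ℕ → {v // shadow hT ξ v ∈ F} := fun n => c^[n] ⟨v₀, hv₀⟩
  have hx : ∀ n, parent hT ξ (x (n + 1)).1 = (x n).1 := fun n => by
    simp only [x]; rw [Function.iterate_succ_apply', hc]
  obtain ⟨y, hy, hyx⟩ := exists_branch_of_descending
    (r := descendingRay (fun n => (x n).1) hx) hx
  refine ⟨(descendingRay (fun n => (x n).1) hx).toEnd, mem_univ _, fun U hU => ?_⟩
  obtain ⟨W, hWU, hW, hη⟩ := mem_nhds_iff.1 hU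
  obtain ⟨m, hm⟩ := exists_shadow_subset hy hW hη
  have h1 := hyx (height hT ξ v₀ - m).toNat
  have h2 : (descendingRay (fun n => (x n).1) hx).toFun 0 = v₀ := rfl
  rw [h2] at h1
  refine mem_of_superset (x (height hT ξ v₀ - m).toNat).2 ?_
  refine Subset.trans ?_ (hm.trans hWU)
  change shadow hT ξ ((descendingRay (fun n => (x n).1) hx).toFun _) ⊆ _
  rw [← h1]
  exact hy.shadow_mono (by omega)

end Branches

/-! ### Brouwer's characterization of the Cantor set. -/

section CantorCharacterization

variable {X : Type*} [TopologicalSpace X]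

/-- Both halves must be decided by `U n`. If `U n` cuts `C`, it does the splitting; if not, `C` is
already decided and any separating set that cuts it will do, as `C` has more than one point. -/
theorem exists_clopen_split {U : ℕ → Set X} (hU : ∀ n, IsClopen (U n))
    (hsep : ∀ x y, x ≠ y → ∃ n, ¬ (x ∈ U n ↔ y ∈ U n)) (hiso : ∀ x : X, ¬ IsOpen {x})
    (C : {C : Set X // IsClopen C ∧ C.Nonempty}) (n : ℕ) :
    ∃ D : Set X, IsClopen D ∧ (C.1 ∩ D).Nonempty ∧ (C.1 \ D).Nonempty ∧
      ((C.1 ∩ D ⊆ U n ∨ Disjoint (C.1 ∩ D) (U n)) ∧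
        (C.1 \ D ⊆ U n ∨ Disjoint (C.1 \ D) (U n))) := by
  obtain ⟨C, hC, x, hx⟩ := C
  by_cases h : (C ∩ U n).Nonempty ∧ (C \ U n).Nonempty
  · exact ⟨U n, hU n, h.1, h.2, Or.inl inter_subset_right, Or.inr disjoint_sdiff_left⟩
  have hside : C ⊆ U n ∨ Disjoint C (U n) := by
    rw [not_and_or, not_nonempty_iff_eq_empty, not_nonempty_iff_eq_empty] at h
    exact h.symm.imp sdiff_eq_empty.1 disjoint_iff_inter_eq_empty.2
  have hy : ∃ y ∈ C, y ≠ x := by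
    by_contra! hc
    exact hiso x (by rw [← eq_singleton_iff_unique_mem.2 ⟨hx, hc⟩]; exact hC.isOpen)
  obtain ⟨y, hy, hyx⟩ := hy
  obtain ⟨m, hm⟩ := hsep y x hyx
  refine ⟨U m, hU m, ?_, ?_, hside.imp inter_subset_left.trans (·.mono_left inter_subset_left),
    hside.imp sdiff_subset.trans (·.mono_left sdiff_subset)⟩
  · by_cases h1 : x ∈ U m
    · exact ⟨x, hx, h1⟩
    · exact ⟨y, hy, by tauto⟩
  · by_cases h1 : x ∈ U m
    · exact ⟨y, hy, by tauto⟩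
    · exact ⟨x, hx, h1⟩

/-- Brouwer's characterization of the Cantor set: a nonempty compact space without isolated points
whose points are separated by countably many clopen sets is homeomorphic to the Cantor set. -/
theorem nonempty_homeomorph_cantorSet [CompactSpace X] [Nonempty X] {U : ℕ → Set X}
    (hU : ∀ n, IsClopen (U n)) (hsep : ∀ x y, x ≠ y → ∃ n, ¬ (x ∈ U n ↔ y ∈ U n))
    (hiso : ∀ x : X, ¬ IsOpen {x}) : Nonempty (X ≃ₜ cantorSet) := by
  choose D hD hne1 hne2 hin hout using exists_clopen_split hU hsep hiso
  let next : ℕ → {C : Set X // IsClopen C ∧ C.Nonempty} → Bool →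
      {C : Set X // IsClopen C ∧ C.Nonempty} := fun n C b =>
    if b then ⟨C.1 ∩ D C n, C.2.1.inter (hD C n), hne1 C n⟩
    else ⟨C.1 \ D C n, C.2.1.diff (hD C n), hne2 C n⟩
  let cell : (ℕ → Bool) → ℕ → {C : Set X // IsClopen C ∧ C.Nonempty} := fun t n =>
    Nat.rec ⟨univ, isClopen_univ, univ_nonempty⟩ (fun n C => next n C (t n)) n
  have hcell : ∀ t n, cell t (n + 1) = next n (cell t n) (t n) := fun t n => rfl
  have hnext : ∀ n C b, (next n C b).1 ⊆ C.1 := by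
    intro n C b
    cases b
    · exact sdiff_subset
    · exact inter_subset_left
  have hside : ∀ n C b, (next n C b).1 ⊆ U n ∨ Disjoint (next n C b).1 (U n) := by
    intro n C b
    cases b
    · exact hout C n
    · exact hin C n
  have hdisj : ∀ n C b b' x, x ∈ (next n C b).1 → x ∈ (next n C b').1 → b = b' := by
    rintro n C (_ | _) (_ | _) x h h'
    · rfl
    · exact absurd h'.2 h.2
    · exact absurd h.2 h'.2
    · rfl
  have hcongr : ∀ t t' n, (∀ i < n, t i = t' i) → cell t n = cell t' n := by
    intro t t' n
    induction n with
    | zero => exact fun _ => rfl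
    | succ n ih =>
      intro h
      rw [hcell, hcell, ih fun i hi => h i (by omega), h n (by omega)]
  have hdet : ∀ t t' n x, x ∈ (cell t n).1 → x ∈ (cell t' n).1 → ∀ i < n, t i = t' i := by
    intro t t' n x
    induction n with
    | zero => intro _ _ i hi; omega
    | succ n ih =>
      intro h h'
      rw [hcell] at h h'
      have h1 := ih (hnext _ _ _ h) (hnext _ _ _ h')
      intro i hi
      rcases Nat.lt_succ_iff_lt_or_eq.1 hi with hi | rfl
      · exact h1 i hi
      · rw [hcongr t t' i h1] at h
        exact hdisj _ _ _ _ _ h h'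
  have hfind : ∀ x, ∃ t, ∀ n, x ∈ (cell t n).1 := by
    intro x
    have hstep : ∀ n (C : {C : Set X // IsClopen C ∧ C.Nonempty}), x ∈ C.1 →
        ∃ b, x ∈ (next n C b).1 := by
      intro n C hx
      by_cases h : x ∈ D C n
      · exact ⟨true, hx, h⟩
      · exact ⟨false, hx, h⟩
    choose b hb using hstep
    -- The recursion carries the membership of `x`, because the choice of the next half depends on
    -- it.
    let s : (n : ℕ) → {C : {C : Set X // IsClopen C ∧ C.Nonempty} // x ∈ C.1} := fun n =>
      Nat.rec ⟨⟨univ, isClopen_univ, univ_nonempty⟩, mem_univ x⟩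
        (fun n C => ⟨next n C.1 (b n C.1 C.2), hb n C.1 C.2⟩) n
    let t : ℕ → Bool := fun n => b n (s n).1 (s n).2
    have hts : ∀ n, cell t n = (s n).1 := by
      intro n
      induction n with
      | zero => rfl
      | succ n ih => exact congrArg (fun C => next n C (t n)) ih
    exact ⟨t, fun n => (hts n).symm ▸ (s n).2⟩
  choose φ hφ using hfind
  have hmem : ∀ t n x, x ∈ (cell t n).1 ↔ ∀ i < n, φ x i = t i := fun t n x =>
    ⟨fun h => hdet _ _ n x (hφ x n) h, fun h => hcongr _ _ n h ▸ hφ x n⟩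
  have hinj : Function.Injective φ := by
    intro x y hxy
    by_contra hne
    obtain ⟨n, hn⟩ := hsep x y hne
    have hx := hφ x (n + 1)
    have hy := hφ y (n + 1)
    rw [← hxy] at hy
    rw [hcell] at hx hy
    -- The cell at stage `n + 1` lies on one side of `U n`, so points with the same address cannot
    -- be separated.
    rcases hside n (cell (φ x) n) (φ x n) with h | h
    · exact hn (iff_of_true (h hx) (h hy))
    · exact hn (iff_of_false (disjoint_left.1 h hx) (disjoint_left.1 h hy))
  have hsurj : Function.Surjective φ := by
    intro t
    obtain ⟨x, hx⟩ := IsCompact.nonempty_iInter_of_sequence_nonempty_isCompact_isClosed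
      (fun n => (cell t n).1) (fun n => by rw [hcell]; exact hnext _ _ _)
      (fun n => (cell t n).2.2) (cell t 0).2.1.isClosed.isCompact
      (fun n => (cell t n).2.1.isClosed)
    refine ⟨x, funext fun i => ?_⟩
    exact (hmem t (i + 1) x).1 (mem_iInter.1 hx (i + 1)) i (Nat.lt_succ_self i)
  have hcont : Continuous φ := by
    refine continuous_pi fun i => ?_
    refine (IsLocallyConstant.iff_exists_open _).2 (fun x => ?_) |>.continuous
    refine ⟨(cell (φ x) (i + 1)).1, (cell (φ x) (i + 1)).2.1.isOpen, hφ x (i + 1), fun y hy => ?_⟩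
    exact (hmem _ _ _).1 hy i (Nat.lt_succ_self i)
  exact ⟨(Continuous.homeoOfEquivCompactToT2 (f := Equiv.ofBijective φ ⟨hinj, hsurj⟩)
    hcont).trans cantorSetHomeomorphNatToBool.symm⟩

end CantorCharacterization

/-! ### The permutation topology: compactness of vertex stabilizers. -/

section AutTopology

theorem nhds_aut (g : T ≃g T) : 𝓝 g = ⨅ v : V, 𝓟 {g' : T ≃g T | g' v = g v} := by
  let _ : TopologicalSpace V := ⊥
  have : DiscreteTopology V := ⟨rfl⟩
  rw [nhds_induced, nhds_pi, Filter.pi, comap_iInf]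
  refine iInf_congr fun v => ?_
  rw [nhds_discrete, comap_comap, comap_pure]
  rfl

theorem le_nhds_aut_iff {F : Filter (T ≃g T)} {g : T ≃g T} :
    F ≤ 𝓝 g ↔ ∀ v, ∀ᶠ g' in F, g' v = g v := by
  rw [nhds_aut, le_iInf_iff]
  simp only [le_principal_iff]
  rfl

theorem eventually_apply_eq (g : T ≃g T) (v : V) : ∀ᶠ g' in 𝓝 g, g' v = g v :=
  le_nhds_aut_iff.1 le_rfl v

theorem isOpen_apply_eq (v w : V) : IsOpen {g : T ≃g T | g v = w} := by
  rw [isOpen_iff_mem_nhds]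
  intro g hg
  filter_upwards [eventually_apply_eq g v] with g' hg'
  exact hg'.trans hg

instance : IsTopologicalGroup (T ≃g T) where
  continuous_mul := by
    refine continuous_iff_continuousAt.2 fun ⟨a, b⟩ => le_nhds_aut_iff.2 fun v => ?_
    have ha : ∀ᶠ p : (T ≃g T) × (T ≃g T) in 𝓝 (a, b), p.1 (b v) = a (b v) :=
      (continuousAt_fst (p := (a, b))).eventually (eventually_apply_eq a (b v))
    have hb : ∀ᶠ p : (T ≃g T) × (T ≃g T) in 𝓝 (a, b), p.2 v = b v :=
      (continuousAt_snd (p := (a, b))).eventually (eventually_apply_eq b v)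
    refine eventually_map.2 ?_
    filter_upwards [ha, hb] with p h1 h2
    change p.1 (p.2 v) = a (b v)
    rw [h2, h1]
  continuous_inv := by
    refine continuous_iff_continuousAt.2 fun a => le_nhds_aut_iff.2 fun v => ?_
    refine eventually_map.2 ?_
    filter_upwards [eventually_apply_eq a (a.symm v)] with g hg
    change g.symm v = a.symm v
    rw [RelIso.symm_apply_eq, hg, RelIso.apply_symm_apply]

theorem finite_orbit_stabilizer (hconn : T.Connected) (hfin : ∀ v : V, (T.neighborSet v).Finite)
    (v w : V) : {u | ∃ g : T ≃g T, g v = v ∧ g w = u}.Finite := by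
  obtain ⟨p⟩ := hconn w v
  induction p with
  | nil => exact (finite_singleton _).subset fun u ⟨g, h1, h2⟩ => h2.symm.trans h1
  | @cons a b c h p ih =>
    refine (ih.biUnion fun u _ => hfin u).subset ?_
    rintro u ⟨g, h1, rfl⟩
    exact mem_biUnion ⟨g, h1, rfl⟩ (g.map_adj_iff.2 h.symm)

/-- Orbits of the stabilizer are finite, so an ultrafilter on it settles on one image for each
vertex; these images define the limit. -/
theorem isCompact_stabilizer_aut (hconn : T.Connected)
    (hfin : ∀ v : V, (T.neighborSet v).Finite) (v : V) : IsCompact {g : T ≃g T | g v = v} := by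
  refine isCompact_iff_ultrafilter_le_nhds.2 fun F hF => ?_
  rw [le_principal_iff] at hF
  have hex : ∀ w, ∃ u, {g : T ≃g T | g w = u} ∈ F := by
    intro w
    have := (Ultrafilter.finite_biUnion_mem_iff (f := F)
      (s := fun u => {g : T ≃g T | g w = u}) (finite_orbit_stabilizer hconn hfin v w)).1
      (mem_of_superset hF fun g hg => mem_biUnion ⟨g, hg, rfl⟩ rfl)
    obtain ⟨u, -, hu⟩ := this
    exact ⟨u, hu⟩
  -- Preimages are settled too, which supplies the inverse and makes the limit bijective.
  have hex' : ∀ w, ∃ u, {g : T ≃g T | g u = w} ∈ F := by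
    intro w
    have := (Ultrafilter.finite_biUnion_mem_iff (f := F)
      (s := fun u => {g : T ≃g T | g u = w}) (finite_orbit_stabilizer hconn hfin v w)).1
      (mem_of_superset hF fun g hg => mem_biUnion (x := g.symm w)
        ⟨g.symm, g.symm_apply_eq.2 (Eq.symm hg), rfl⟩ (g.apply_symm_apply w))
    obtain ⟨u, -, hu⟩ := this
    exact ⟨u, hu⟩
  choose f hf using hex
  choose f' hf' using hex'
  let e : T ≃g T :=
    { toFun := f
      invFun := f'
      left_inv := fun w => by
        obtain ⟨g, h1, h2⟩ := Filter.nonempty_of_mem (inter_mem (hf w) (hf' (f w)))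
        exact g.injective (h2.trans (Eq.symm h1))
      right_inv := fun w => by
        obtain ⟨g, h1, h2⟩ := Filter.nonempty_of_mem (inter_mem (hf (f' w)) (hf' w))
        exact (Eq.symm h1).trans h2
      map_rel_iff' := by
        intro a b
        obtain ⟨g, h1, h2⟩ := Filter.nonempty_of_mem (inter_mem (hf a) (hf b))
        change T.Adj (f a) (f b) ↔ T.Adj a b
        rw [← show g a = f a from h1, ← show g b = f b from h2, g.map_adj_iff] }
  refine ⟨e, ?_, le_nhds_aut_iff.2 hf⟩
  obtain ⟨g, h1, h2⟩ := Filter.nonempty_of_mem (inter_mem (hf v) hF)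
  exact (Eq.symm h1).trans h2

theorem countable_of_locallyFinite (hconn : T.Connected)
    (hfin : ∀ v : V, (T.neighborSet v).Finite) : Countable V := by
  obtain ⟨o⟩ := hconn.nonempty
  let B : ℕ → Set V := fun n => Nat.rec {o} (fun _ S => ⋃ u ∈ S, T.neighborSet u) n
  have hB : ∀ n, (B n).Finite := by
    intro n
    induction n with
    | zero => exact finite_singleton o
    | succ n ih => exact ih.biUnion fun u _ => hfin u
  have hall : ∀ v, ∃ n, v ∈ B n := by
    intro v
    obtain ⟨p⟩ := hconn v o
    clear hB
    induction p with
    | nil => exact ⟨0, rfl⟩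
    | @cons a b c h p ih =>
      obtain ⟨n, hn⟩ := ih
      exact ⟨n + 1, mem_biUnion hn h.symm⟩
  rw [← countable_univ_iff]
  refine (countable_iUnion fun n => (hB n).countable).mono fun v _ => mem_iUnion.2 (hall v)

end AutTopology

/-! ### Stabilizers and translations in the closed subgroup. -/

section Action

variable {G : Subgroup (T ≃g T)}

theorem isOpen_smul_eq (v w : V) : IsOpen {g : G | g • v = w} :=
  (isOpen_apply_eq v w).preimage continuous_subtype_val

theorem isOpen_stabilizer (v : V) : IsOpen (MulAction.stabilizer G v : Set G) :=
  isOpen_smul_eq v v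

theorem isCompact_stabilizer (hT : T.IsTree) (hfin : ∀ v : V, (T.neighborSet v).Finite)
    (hclosed : IsClosed (G : Set (T ≃g T))) (v : V) :
    IsCompact (MulAction.stabilizer G v : Set G) :=
  hclosed.isClosedEmbedding_subtypeVal.isCompact_preimage
    (isCompact_stabilizer_aut hT.connected hfin v)

/-- Powers of a translation move a vertex of its axis to infinitely many places, whereas a vertex
stabilizer has finite orbits. -/
theorem not_isTranslation_of_fixed (hT : T.IsTree) (hfin : ∀ v : V, (T.neighborSet v).Finite)
    {g : T ≃g T} {x : V} (hx : g x = x) : ¬ IsTranslation g := by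
  rintro ⟨l, η, hl, L, -, hL⟩
  have hpow : ∀ k : ℕ, (g ^ k) x = x ∧ (g ^ k) (L.toFun 0) = L.toFun (k * l) := by
    intro k
    induction k with
    | zero => simp
    | succ k ih =>
      rw [pow_succ', RelIso.mul_apply, RelIso.mul_apply, ih.1, ih.2, hL]
      refine ⟨hx, ?_⟩
      congr 1; push_cast; ring
  have hmem : ∀ k : ℕ, L.toFun (k * l) ∈ {u | ∃ g : T ≃g T, g x = x ∧ g (L.toFun 0) = u} :=
    fun k => ⟨g ^ k, (hpow k).1, (hpow k).2⟩
  refine Set.infinite_of_injective_forall_mem ?_ hmem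
    (finite_orbit_stabilizer hT.connected hfin x (L.toFun 0))
  intro a b hab
  have := L.inj hab
  have hl' : (l : ℤ) ≠ 0 := by omega
  exact_mod_cast mul_right_cancel₀ hl' this

end Action

/-! ### The shift homomorphism and the axis of an element moving towards `ξ`. -/

section Shift

variable (hT : T.IsTree) {ξ : Ends T} {G : Subgroup (T ≃g T)} (hfix : ∀ g : G, g • ξ = ξ)

/-- The amount by which an element of a group fixing `ξ` moves the vertices towards `ξ`. -/
noncomputable def shift (_ : ∀ g : G, g • ξ = ξ) (g : G) : ℤ :=
  height hT ξ (g • hT.connected.nonempty.some) - height hT ξ hT.connected.nonempty.some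

theorem height_smul (g : G) (v : V) :
    height hT ξ (g • v) = height hT ξ v + shift hT hfix g := by
  have := height_map_sub (g := (g : T ≃g T)) hT (hfix g) v hT.connected.nonempty.some
  change height hT ξ (g • v) - _ = height hT ξ (g • _) - _ at this
  unfold shift
  omega

theorem smul_parent (hfix : ∀ g : G, g • ξ = ξ) (g : G) (v : V) :
    g • parent hT ξ v = parent hT ξ (g • v) :=
  map_parent (g := (g : T ≃g T)) hT (hfix g) v

theorem smul_iterate_parent (hfix : ∀ g : G, g • ξ = ξ) (g : G) (n : ℕ) (v : V) :
    g • (parent hT ξ)^[n] v = (parent hT ξ)^[n] (g • v) :=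
  map_iterate_parent (g := (g : T ≃g T)) hT (hfix g) n v

theorem shift_mul (g k : G) : shift hT hfix (g * k) = shift hT hfix g + shift hT hfix k := by
  have v := hT.connected.nonempty.some
  have h1 := height_smul hT hfix (g * k) v
  rw [mul_smul, height_smul hT hfix, height_smul hT hfix] at h1
  omega

theorem shift_one : shift hT hfix 1 = 0 := by
  have := shift_mul hT hfix 1 1
  rw [mul_one] at this
  omega

theorem shift_inv (g : G) : shift hT hfix g⁻¹ = -shift hT hfix g := by
  have := shift_mul hT hfix g⁻¹ g
  rw [inv_mul_cancel, shift_one] at this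
  omega

theorem shift_pow (g : G) (n : ℕ) : shift hT hfix (g ^ n) = n * shift hT hfix g := by
  induction n with
  | zero => simp [shift_one]
  | succ n ih => rw [pow_succ, shift_mul, ih]; push_cast; ring

theorem shift_zpow (g : G) (n : ℤ) : shift hT hfix (g ^ n) = n * shift hT hfix g := by
  cases n with
  | ofNat n => simpa using shift_pow hT hfix g n
  | negSucc n => rw [zpow_negSucc, shift_inv, shift_pow, Int.negSucc_eq]; push_cast; ring

theorem shift_eq_zero_of_fixed {g : G} {v : V} (h : g • v = v) : shift hT hfix g = 0 := by
  have := height_smul hT hfix g v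
  rw [h] at this
  omega

theorem isLocallyConstant_shift : IsLocallyConstant (shift hT hfix) := by
  refine (IsLocallyConstant.iff_exists_open _).2 fun g => ?_
  have v := hT.connected.nonempty.some
  refine ⟨{k | k • v = g • v}, isOpen_smul_eq v _, rfl, fun k hk => ?_⟩
  have h1 := height_smul hT hfix k v
  have h2 := height_smul hT hfix g v
  rw [show k • v = g • v from hk] at h1
  omega

/-- Here `v` and `g • v` have equal height, so they reach their common ancestors after equally many
steps, and `g` commutes with `parent`. -/
theorem exists_fixed_iterate {g : G} (h : shift hT hfix g = 0) (v : V) :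
    ∃ N, ∀ n ≥ N, g • (parent hT ξ)^[n] v = (parent hT ξ)^[n] v := by
  obtain ⟨N, hN⟩ := exists_common_ancestor_of_le hT (ξ := ξ) (g • v) v
  have h1 := height_smul hT hfix g v
  refine ⟨(N - height hT ξ v).toNat, fun n hn => ?_⟩
  rw [smul_iterate_parent hT hfix]
  exact hN n n (by omega) (by omega)

variable {hT}

theorem IsBranchOf.smul_apply {y : ℤ → V} {η : Ends T} (hy : IsBranchOf hT ξ y η) {g : G}
    (hg : g • η = η) (n : ℤ) : g • y n = y (n + shift hT hfix g) := by
  have h := hy.smul (g := (g : T ≃g T)) (hfix g) (c := shift hT hfix g) (height_smul hT hfix g)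
  rw [show (g : T ≃g T) • η = η from hg] at h
  have h2 := congrFun (hy.unique h) (n + shift hT hfix g)
  simp only [add_sub_cancel_right] at h2
  exact h2.symm

theorem IsBranchOf.isTranslationTowards {y : ℤ → V} {η : Ends T} (hy : IsBranchOf hT ξ y η)
    {g : G} (hg : g • η = η) {l : ℕ} (hl : 0 < l) (hs : shift hT hfix g = l) :
    IsTranslationTowards (g : T ≃g T) l ξ := by
  refine ⟨hl, hy.line, hy.line_posEnd, fun n => ?_⟩
  rw [← hs]
  exact hy.smul_apply hfix hg n

theorem smul_mem_shadow_smul_iff (hfix : ∀ g : G, g • ξ = ξ) (g : G) {η : Ends T} {v : V} :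
    g • η ∈ shadow hT ξ (g • v) ↔ η ∈ shadow hT ξ v :=
  smul_mem_shadow_iff (g := (g : T ≃g T)) (hfix g)

/-- An element moving the vertices towards `ξ` fixes another end, the repelling end of its axis. -/
theorem exists_fixed_end {g : G} (hg : 0 < shift hT hfix g) : ∃ η, η ≠ ξ ∧ g • η = η := by
  obtain ⟨l, hl⟩ := Int.eq_ofNat_of_zero_le hg.le
  set p := parent hT ξ with hp
  -- High enough above any vertex, `g` acts as the `l`-fold parent map.
  obtain ⟨x, hx⟩ : ∃ x, g • x = p^[l] x := by
    obtain ⟨v⟩ := hT.connected.nonempty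
    obtain ⟨N, hN⟩ := exists_common_ancestor_of_le hT (ξ := ξ) (g • v) v
    have h1 := height_smul hT hfix g v
    refine ⟨p^[(N - height hT ξ v).toNat] v, ?_⟩
    rw [hp, smul_iterate_parent hT hfix, ← Function.iterate_add_apply]
    exact hN _ _ (by omega) (by push_cast; omega)
  have hcomm : ∀ (g : G) n v, g • p^[n] v = p^[n] (g • v) := smul_iterate_parent hT hfix
  -- Pulling the ray from `x` back by powers of `g` extends it downwards. `W k m` sits `m - k * l`
  -- above `x` and depends only on that number.
  let W : ℕ → ℕ → V := fun k m => (g ^ k)⁻¹ • p^[m] x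
  have hW1 : ∀ k m, W (k + 1) (m + l) = W k m := by
    intro k m
    simp only [W]
    rw [inv_smul_eq_iff, pow_succ', mul_smul, smul_inv_smul, hcomm, hx,
      ← Function.iterate_add_apply]
  have hW : ∀ j k m, W (k + j) (m + j * l) = W k m := by
    intro j k m
    induction j with
    | zero => simp
    | succ j ih => rw [← ih, ← hW1 (k + j)]; congr 1; ring
  have hWeq : ∀ k m k' m' : ℕ, (m : ℤ) - k * l = m' - k' * l → W k m = W k' m' := by
    intro k m k' m' h
    rw [← hW k' k m, ← hW k k' m']
    congr 1
    · ring
    · zify; linarith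
  have hl0 : (1 : ℤ) ≤ l := by omega
  have hnn : ∀ n : ℤ, 0 ≤ n + n.natAbs * l := fun n => by
    have : (n.natAbs : ℤ) ≤ n.natAbs * l := le_mul_of_one_le_right (by omega) hl0
    omega
  -- Since `l ≥ 1`, taking `k = |n|` makes `n + k * l` nonnegative.
  let y : ℤ → V := fun n => W n.natAbs (n + n.natAbs * l).toNat
  have hy : ∀ (n : ℤ) (k m : ℕ), n = m - k * l → y n = W k m := by
    intro n k m h
    refine hWeq _ _ _ _ ?_
    rw [Int.toNat_of_nonneg (hnn n)]
    omega
  have hnn' : ∀ n : ℤ, ((n + n.natAbs * l).toNat : ℤ) = n + n.natAbs * l := fun n =>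
    Int.toNat_of_nonneg (hnn n)
  have hyp : ∀ n, p (y n) = y (n + 1) := by
    intro n
    have h1 := hy n n.natAbs (n + n.natAbs * l).toNat (by
      rw [hnn']; ring)
    have h2 := hy (n + 1) n.natAbs ((n + n.natAbs * l).toNat + 1) (by
      rw [Nat.cast_add, hnn']; push_cast; ring)
    rw [h1, h2]
    simp only [W]
    rw [Function.iterate_succ_apply', hp, smul_parent hT hfix]
  have hgy : ∀ n, g • y n = y (n + l) := by
    intro n
    have h1 := hy n (n.natAbs + 1) ((n + n.natAbs * l).toNat + l) (by
      rw [Nat.cast_add, hnn']; push_cast; ring)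
    have h2 := hy (n + l) n.natAbs ((n + n.natAbs * l).toNat + l) (by
      rw [Nat.cast_add, hnn']; push_cast; ring)
    rw [h1, h2]
    simp only [W]
    rw [pow_succ, mul_inv_rev, ← mul_smul, ← mul_assoc, mul_inv_cancel, one_mul]
  have hh : ∀ n, height hT ξ (y n) = n + height hT ξ (y 0) := by
    have hup : ∀ n (k : ℕ), height hT ξ (y (n + k)) = height hT ξ (y n) + k := by
      intro n k
      induction k with
      | zero => simp
      | succ k ih => push_cast; rw [← add_assoc, ← hyp, hp, height_parent, ih]; ring
    intro n
    rcases le_total 0 n with hn | hn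
    · obtain ⟨k, hk⟩ := Int.exists_add_of_le hn
      rw [hk, hup]; ring
    · obtain ⟨k, hk⟩ := Int.exists_add_of_le hn
      have := hup n k
      rw [← hk] at this
      omega
  obtain ⟨η, hη⟩ := IsBranchOf.of_parent_eq (hT := hT) (ξ := ξ)
    (y := fun n => y (n - height hT ξ (y 0)))
    (fun n => by rw [← hp, hyp]; congr 1; ring) (fun n => by rw [hh]; ring)
  refine ⟨η, hη.ne, ?_⟩
  have h := hη.smul (g := (g : T ≃g T)) (hfix g) (c := shift hT hfix g) (height_smul hT hfix g)
  have : (fun n => (g : T ≃g T) (y (n - shift hT hfix g - height hT ξ (y 0)))) =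
      fun n => y (n - height hT ξ (y 0)) := by
    funext n
    change g • y _ = _
    rw [hgy]; congr 1
    omega
  rw [this] at h
  exact h.end_unique hη

end Shift

/-! ### The stabilizer of `ξ'` and its splitting. -/

section Stabilizer

variable {hT : T.IsTree} {ξ ξ' : Ends T} {G : Subgroup (T ≃g T)} {y : ℤ → V}

theorem smul_ne_of_ne (hfix : ∀ g : G, g • ξ = ξ) (g : G) {η : Ends T} (hη : η ≠ ξ) :
    g • η ≠ ξ := fun h => hη (by rw [← hfix g] at h; exact MulAction.injective g h)

theorem IsBranchOf.mem_lineFixator (hy : IsBranchOf hT ξ y ξ') {g : G} :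
    g ∈ lineFixator G ξ ξ' ↔ ∀ n, g • y n = y n := by
  unfold lineFixator
  rw [hy.lineBetween_eq, mem_fixingSubgroup_iff]
  simp

theorem IsBranchOf.mem_lineFixator_iff_shift (hy : IsBranchOf hT ξ y ξ')
    (hfix : ∀ g : G, g • ξ = ξ) {g : G} :
    g ∈ lineFixator G ξ ξ' ↔ g • ξ' = ξ' ∧ shift hT hfix g = 0 := by
  rw [hy.mem_lineFixator]
  constructor
  · intro h
    have hs := shift_eq_zero_of_fixed hT hfix (h 0)
    refine ⟨?_, hs⟩
    have h1 := hy.smul (g := (g : T ≃g T)) (hfix g) (c := shift hT hfix g) (height_smul hT hfix g)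
    have h2 : (fun n => (g : T ≃g T) (y (n - shift hT hfix g))) = y := by
      funext n
      rw [hs, sub_zero]
      exact h n
    rw [h2] at h1
    exact h1.end_unique hy
  · rintro ⟨h1, h2⟩ n
    rw [hy.smul_apply hfix h1, h2, add_zero]

theorem IsBranchOf.isCompact_lineFixator (hy : IsBranchOf hT ξ y ξ')
    (hfin : ∀ v : V, (T.neighborSet v).Finite) (hclosed : IsClosed (G : Set (T ≃g T))) :
    IsCompact (lineFixator G ξ ξ' : Set G) := by
  have : (lineFixator G ξ ξ' : Set G) = ⋂ n, (MulAction.stabilizer G (y n) : Set G) := by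
    ext g
    simp only [mem_iInter, SetLike.mem_coe, hy.mem_lineFixator, MulAction.mem_stabilizer_iff]
  rw [this]
  refine (isCompact_stabilizer hT hfin hclosed (y 0)).of_isClosed_subset ?_ (iInter_subset _ 0)
  exact isClosed_iInter fun n => Subgroup.isClosed_of_isOpen _ (isOpen_stabilizer (y n))

/-- The translations towards `ξ` of minimal length can be found in the stabilizer of `ξ'`, and
their length divides all other ones. -/
theorem exists_minimal_translation (hfix : ∀ g : G, g • ξ = ξ)
    (htrans : ∀ η η' : Ends T, η ≠ ξ → η' ≠ ξ → ∃ g : G, g • η = η') (hne : ξ' ≠ ξ)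
    (h : ∃ g : G, shift hT hfix g ≠ 0) :
    ∃ (s : G) (l : ℕ), 0 < l ∧ s • ξ' = ξ' ∧ shift hT hfix s = l ∧
      ∀ g : G, (l : ℤ) ∣ shift hT hfix g := by
  classical
  have hex : ∃ l : ℕ, 0 < l ∧ ∃ g : G, shift hT hfix g = l := by
    obtain ⟨g, hg⟩ := h
    rcases lt_or_gt_of_ne hg with h | h
    · exact ⟨(shift hT hfix g).natAbs, by omega, g⁻¹, by rw [shift_inv]; omega⟩
    · exact ⟨(shift hT hfix g).natAbs, by omega, g, by omega⟩
  obtain ⟨hl, g, hg⟩ := Nat.find_spec hex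
  have hmin : ∀ m, m < Nat.find hex → ¬ _ := fun m => Nat.find_min hex
  set l := Nat.find hex
  obtain ⟨η, hη, hgη⟩ := exists_fixed_end (hT := hT) hfix (g := g) (by omega)
  -- Conjugating by `k` moves the second fixed end to `ξ'` without changing the shift.
  obtain ⟨k, rfl⟩ := htrans ξ' η hne hη
  refine ⟨k⁻¹ * g * k, l, hl, ?_, ?_, fun a => ?_⟩
  · rw [mul_smul, mul_smul, hgη, inv_smul_smul]
  · rw [shift_mul, shift_mul, shift_inv]; omega
  · have hl' : (l : ℤ) ≠ 0 := by omega
    -- Division with remainder: a nonzero remainder would be a smaller positive shift.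
    have h1 : shift hT hfix (a * g ^ (-(shift hT hfix a / l))) = shift hT hfix a % l := by
      rw [shift_mul, shift_zpow, hg, Int.emod_def]; ring
    have h2 := Int.emod_nonneg (shift hT hfix a) hl'
    have h3 := Int.emod_lt_of_pos (shift hT hfix a) (show (0 : ℤ) < l by omega)
    by_contra hdvd
    rw [Int.dvd_iff_emod_eq_zero] at hdvd
    exact hmin (shift hT hfix a % l).toNat (by omega) ⟨by omega, _, h1.trans (by omega)⟩

theorem IsBranchOf.isSemidirectDecomposition (hy : IsBranchOf hT ξ y ξ')
    (hfix : ∀ g : G, g • ξ = ξ) {s : G} {l : ℕ} (hl : 0 < l) (hs : s • ξ' = ξ')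
    (hsl : shift hT hfix s = l) (hdvd : ∀ g : G, (l : ℤ) ∣ shift hT hfix g) :
    IsSemidirectDecomposition (MulAction.stabilizer G ξ') (lineFixator G ξ ξ')
      (Subgroup.zpowers s) := by
  have hl' : (l : ℤ) ≠ 0 := by omega
  have hmem : ∀ g : G, g ∈ lineFixator G ξ ξ' ↔ g • ξ' = ξ' ∧ shift hT hfix g = 0 :=
    fun g => hy.mem_lineFixator_iff_shift hfix
  have hsz : ∀ n : ℤ, s ^ n ∈ MulAction.stabilizer G ξ' := fun n =>
    zpow_mem (MulAction.mem_stabilizer_iff.2 hs) n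
  refine ⟨fun g hg => ((hmem g).1 hg).1, Subgroup.zpowers_le.2 hs, ?_, ?_, ?_, ?_⟩
  · intro k hk n hn
    rw [hmem] at hn ⊢
    refine ⟨?_, by rw [shift_mul, shift_mul, shift_inv, hn.2]; ring⟩
    rw [mul_smul, mul_smul, inv_smul_eq_iff.2 (MulAction.mem_stabilizer_iff.1 hk).symm, hn.1, hk]
  · rw [eq_bot_iff]
    rintro g ⟨hg, n, rfl⟩
    have h1 := ((hmem _).1 hg).2
    simp only [shift_zpow, hsl] at h1
    have : n = 0 := (mul_eq_zero.1 h1).resolve_right hl'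
    simp [this]
  · ext g
    constructor
    · rintro ⟨a, ha, _, ⟨n, rfl⟩, rfl⟩
      exact mul_mem (s := MulAction.stabilizer G ξ') ((hmem a).1 ha).1 (hsz n)
    · intro hg
      obtain ⟨n, hn⟩ := hdvd g
      refine ⟨g * (s ^ n)⁻¹, (hmem _).2 ⟨?_, ?_⟩, s ^ n, ⟨n, rfl⟩, by simp⟩
      · exact mul_mem (s := MulAction.stabilizer G ξ') hg (inv_mem (hsz n))
      · rw [shift_mul, shift_inv, shift_zpow, hsl, hn]; ring
  -- The shift recovers the power of `s` from a product. It is locally constant, so the inverse of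
  -- multiplication is continuous.
  · let q : G → G := fun g => s ^ (shift hT hfix g / l)
    have hq : Continuous q :=
      ((isLocallyConstant_shift hT hfix).comp fun n : ℤ => s ^ (n / (l : ℤ))).continuous
    refine IsEmbedding.of_comp (g := fun g => (g * (q g)⁻¹, q g)) (by fun_prop)
      ((continuous_id.mul hq.inv).prodMk hq) ?_
    convert (IsEmbedding.subtypeVal (p := (· ∈ lineFixator G ξ ξ'))).prodMap
      (IsEmbedding.subtypeVal (p := (· ∈ Subgroup.zpowers s))) using 1
    funext ⟨⟨a, ha⟩, ⟨_, ⟨n, rfl⟩⟩⟩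
    have : q (a * s ^ n) = s ^ n := by
      simp only [q]
      rw [shift_mul, shift_zpow, ((hmem a).1 ha).2, hsl, zero_add, Int.mul_ediv_cancel _ hl']
    simp [this]

theorem IsBranchOf.isCompactlyGenerated_stabilizer (hy : IsBranchOf hT ξ y ξ')
    (hfix : ∀ g : G, g • ξ = ξ)
    (htrans : ∀ η η' : Ends T, η ≠ ξ → η' ≠ ξ → ∃ g : G, g • η = η')
    (hfin : ∀ v : V, (T.neighborSet v).Finite) (hclosed : IsClosed (G : Set (T ≃g T))) :
    IsCompactlyGenerated (MulAction.stabilizer G ξ') := by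
  have hcpt := hy.isCompact_lineFixator (G := G) hfin hclosed
  by_cases h : ∃ g : G, shift hT hfix g ≠ 0
  · obtain ⟨s, l, hl, hs, hsl, hdvd⟩ := exists_minimal_translation hfix htrans hy.ne h
    have hdec := hy.isSemidirectDecomposition hfix hl hs hsl hdvd
    refine ⟨lineFixator G ξ ξ' ∪ {s}, hcpt.union isCompact_singleton, le_antisymm ?_ ?_⟩
    · rw [Subgroup.closure_le]
      exact union_subset hdec.left_le (singleton_subset_iff.2 hs)
    · intro g hg
      rw [← SetLike.mem_coe, ← hdec.mul_eq] at hg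
      obtain ⟨a, ha, _, ⟨n, rfl⟩, rfl⟩ := hg
      exact mul_mem (Subgroup.subset_closure (Or.inl ha))
        (zpow_mem (Subgroup.subset_closure (mem_union_right _ (mem_singleton s))) n)
  · push Not at h
    refine ⟨lineFixator G ξ ξ', hcpt, ?_⟩
    rw [Subgroup.closure_eq]
    ext g
    rw [hy.mem_lineFixator_iff_shift hfix, MulAction.mem_stabilizer_iff]
    simp [h g]

theorem actsWithoutTranslation_of_shift (hfin : ∀ v : V, (T.neighborSet v).Finite)
    (hfix : ∀ g : G, g • ξ = ξ) (h : ∀ g : G, shift hT hfix g = 0) :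
    ActsWithoutTranslation G := by
  intro g hg
  obtain ⟨v⟩ := hT.connected.nonempty
  obtain ⟨N, hN⟩ := exists_fixed_iterate hT hfix (h ⟨g, hg⟩) v
  exact not_isTranslation_of_fixed hT hfin (x := (parent hT ξ)^[N] v) (hN N le_rfl)

theorem isolatedEndCase_of_isOpen (hfin : ∀ v : V, (T.neighborSet v).Finite)
    (hfix : ∀ g : G, g • ξ = ξ) (h : ∀ g : G, shift hT hfix g = 0)
    (hopen : IsOpen ({ξ} : Set (Ends T))) : IsolatedEndCase G ξ := by
  have := compactSpace_ends hT ξ hfin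
  exact ⟨hopen, hopen.isClosed_compl.isCompact, actsWithoutTranslation_of_shift hfin hfix h⟩

end Stabilizer

/-! ### The lineal case. -/

section Lineal

variable {hT : T.IsTree} {ξ ξ' : Ends T} {G : Subgroup (T ≃g T)} {y : ℤ → V}

theorem IsBranchOf.isTranslation (hy : IsBranchOf hT ξ y ξ') (hfix : ∀ g : G, g • ξ = ξ) {g : G}
    (hg : g • ξ' = ξ') (hs : shift hT hfix g ≠ 0) : IsTranslation (g : T ≃g T) := by
  rcases lt_or_gt_of_ne hs with h | h
  · let L : Line T :=
      { toFun := fun n => y (-n)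
        adj := fun n => by
          have h1 := (hy.line.adj (-n - 1)).symm
          rw [sub_add_cancel] at h1
          rwa [neg_add, ← sub_eq_add_neg]
        inj := fun a b hab => by simpa using hy.line.inj hab }
    refine ⟨(shift hT hfix g).natAbs, L.posEnd, by omega, L, rfl, fun n => ?_⟩
    refine (hy.smul_apply hfix hg (-n)).trans ?_
    simp only [L]
    congr 1; omega
  · exact ⟨(shift hT hfix g).natAbs, ξ,
      hy.isTranslationTowards hfix hg (by omega) (by omega)⟩

/-- Every vertex has a nonempty shadow, which can only contain `ξ'`, so every vertex lies on `y`. An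
element is then determined by its shift. -/
theorem IsBranchOf.linealCase (hy : IsBranchOf hT ξ y ξ') (hleaf : Leafless T)
    (hfix : ∀ g : G, g • ξ = ξ)
    {s : G} {l : ℕ} (hl : 0 < l) (hsl : shift hT hfix s = l)
    (hdvd : ∀ g : G, (l : ℤ) ∣ shift hT hfix g) (hX : ∀ η, η ≠ ξ → η = ξ') :
    LinealCase G ξ ξ' := by
  have hl' : (l : ℤ) ≠ 0 := by omega
  have hline : ∀ v, y (height hT ξ v) = v := by
    intro v
    obtain ⟨η, hη⟩ := shadow_nonempty (hT := hT) (ξ := ξ) hleaf v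
    have h1 : η ≠ ξ := by rintro rfl; exact not_mem_shadow_end v hη
    rw [hX η h1] at hη
    exact hy.mem_shadow.1 hη
  have hstab : ∀ g : G, g • ξ' = ξ' := fun g => hX _ (smul_ne_of_ne hfix g hy.ne)
  have hone : ∀ g : G, shift hT hfix g = 0 → g = 1 := by
    intro g hg
    refine Subtype.ext (RelIso.ext fun v => ?_)
    change g • v = v
    rw [← hline v, hy.smul_apply hfix (hstab g), hg, add_zero]
  refine ⟨?_, ?_, ?_, ?_⟩
  · rw [hy.lineBetween_eq]
    exact eq_univ_of_forall fun v => ⟨_, hline v⟩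
  · exact eq_top_iff.2 fun g _ => hstab g
  · have hdisc : DiscreteTopology G := by
      refine discreteTopology_of_isOpen_singleton_one ?_
      convert isOpen_stabilizer (G := G) (y 0)
      ext g
      constructor
      · rintro rfl
        exact one_mem _
      · exact fun h => hone g (shift_eq_zero_of_fixed hT hfix h)
    have hbij : Function.Bijective (zpowersHom G s) := by
      constructor
      · intro a b hab
        have h1 := congrArg (shift hT hfix) hab
        simp only [zpowersHom_apply, shift_zpow, hsl] at h1
        exact Multiplicative.toAdd.injective (mul_right_cancel₀ hl' h1)
      · intro g
        obtain ⟨n, hn⟩ := hdvd g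
        refine ⟨Multiplicative.ofAdd n, ?_⟩
        rw [zpowersHom_apply, toAdd_ofAdd, ← inv_mul_eq_one]
        exact hone _ (by rw [shift_mul, shift_inv, shift_zpow, hsl, hn]; ring)
    exact ⟨{ (MulEquiv.ofBijective _ hbij).symm with
      continuous_toFun := continuous_of_discreteTopology
      continuous_invFun := continuous_of_discreteTopology }⟩
  · intro g hg hg1
    exact hy.isTranslation hfix (g := ⟨g, hg⟩) (hstab _) fun h =>
      hg1 (congrArg Subtype.val (hone _ h))

end Lineal

/-! ### The horocyclic case. -/

section Horocyclic

variable {hT : T.IsTree} {ξ ξ' : Ends T} {G : Subgroup (T ≃g T)} {y : ℤ → V}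

/-- The fibres of the first map are the shadows of the translates of `y n`, which are compact and
open, so it is of type (C); the coset space is discrete, so the second map is of type (D). -/
theorem IsBranchOf.exists_cdiFactorization (hy : IsBranchOf hT ξ y ξ') (hne : ξ' ≠ ξ)
    (hfin : ∀ v : V, (T.neighborSet v).Finite) (hfix : ∀ g : G, g • ξ = ξ)
    (htrans : ∀ η η' : Ends T, η ≠ ξ → η' ≠ ξ → ∃ g : G, g • η = η')
    (h : ∀ g : G, shift hT hfix g = 0) (n : ℤ) :
    ∃ π : otherEnds G ξ hfix → G ⧸ MulAction.stabilizer G (y n),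
      (∀ g : G, π (g • (⟨ξ', hne⟩ : otherEnds G ξ hfix)) =
        (g : G ⧸ MulAction.stabilizer G (y n))) ∧
      IsCDIFactorization G π (fun _ => PUnit.unit) := by
  have hdisc : DiscreteTopology (G ⧸ MulAction.stabilizer G (y n)) :=
    QuotientGroup.discreteTopology (isOpen_stabilizer (y n))
  choose c hc using fun η : otherEnds G ξ hfix => htrans ξ' η.1 hne η.2
  let π : otherEnds G ξ hfix → G ⧸ MulAction.stabilizer G (y n) := fun η => (c η : G)
  have hmem : ∀ a b : G, a • ξ' ∈ shadow hT ξ (b • y n) ↔ a • y n = b • y n := by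
    intro a b
    have h1 := (smul_mem_shadow_smul_iff (G := G) hfix a).2 (hy.mem_shadow_self n)
    -- As no element shifts, both translates are at height `n`, where shadows of distinct vertices
    -- are disjoint.
    refine ⟨fun h2 => eq_of_mem_shadow h1 h2 ?_, fun h2 => h2 ▸ h1⟩
    rw [height_smul hT hfix, height_smul hT hfix, h, h]
  have hfibre : ∀ (g : G) (η : otherEnds G ξ hfix),
      π η = (g : G ⧸ MulAction.stabilizer G (y n)) ↔ η.1 ∈ shadow hT ξ (g • y n) := by
    intro g η
    rw [← hc η, hmem]
    simp only [π]
    rw [QuotientGroup.eq, MulAction.mem_stabilizer_iff, mul_smul, inv_smul_eq_iff, eq_comm]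
  have hπ : ∀ g : G, π (g • (⟨ξ', hne⟩ : otherEnds G ξ hfix)) =
      (g : G ⧸ MulAction.stabilizer G (y n)) := fun g =>
    (hfibre g _).2 ((hmem g g).2 rfl)
  have hcont : Continuous π := by
    refine continuous_discrete_rng.2 fun q => ?_
    obtain ⟨g, rfl⟩ := QuotientGroup.mk_surjective q
    have : π ⁻¹' {(g : G ⧸ MulAction.stabilizer G (y n))} =
        Subtype.val ⁻¹' shadow hT ξ (g • y n) := ext fun η => hfibre g η
    rw [this]
    exact (isClopen_shadow _).isOpen.preimage continuous_subtype_val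
  have hsurj : Function.Surjective π := fun q => by
    obtain ⟨g, rfl⟩ := QuotientGroup.mk_surjective q
    exact ⟨_, hπ g⟩
  have hequiv : ∀ (g : G) (η : otherEnds G ξ hfix), π (g • η) = g • π η := by
    intro g η
    have h1 : η = c η • (⟨ξ', hne⟩ : otherEnds G ξ hfix) := Subtype.ext (hc η).symm
    have h2 : g • η = (g * c η) • (⟨ξ', hne⟩ : otherEnds G ξ hfix) := by
      rw [mul_smul, ← h1]
    rw [h2, hπ]
    rfl
  refine ⟨π, hπ, ⟨⟨?_, hequiv, ?_, ?_⟩, Or.inl ?_⟩,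
    ⟨⟨?_, fun _ _ => rfl, ?_, ?_⟩, Or.inr (Or.inl ?_)⟩⟩
  · exact IsOpenMap.isQuotientMap (fun _ _ => isOpen_discrete _) hcont hsurj
  · exact isClosed_eq (hcont.comp continuous_fst) (hcont.comp continuous_snd)
  · intro g a b hab
    change π (g • a) = π (g • b)
    rw [hequiv, hequiv, show π a = π b from hab]
  · refine ⟨range singleton, fun _ _ => isOpen_discrete _, ?_, ?_⟩
    · exact eq_univ_of_forall fun q => ⟨{q}, ⟨q, rfl⟩, rfl⟩
    · rintro _ ⟨q, rfl⟩
      rw [((isClosed_discrete {q}).preimage hcont).closure_eq]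
      obtain ⟨g, rfl⟩ := QuotientGroup.mk_surjective q
      rw [Subtype.isCompact_iff]
      have : Subtype.val '' (π ⁻¹' {(g : G ⧸ MulAction.stabilizer G (y n))}) =
          shadow hT ξ (g • y n) := by
        ext η
        constructor
        · rintro ⟨η, hη, rfl⟩
          exact (hfibre g η).1 hη
        · intro hη
          have h1 : η ≠ ξ := by rintro rfl; exact not_mem_shadow_end _ hη
          exact ⟨⟨η, h1⟩, (hfibre g ⟨η, h1⟩).2 hη, rfl⟩
      have hcpt := compactSpace_ends hT ξ hfin
      exact this ▸ (isClopen_shadow _).isClosed.isCompact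
  · exact IsOpenMap.isQuotientMap (fun _ _ => isOpen_discrete _) continuous_const
      fun _ => ⟨((1 : G) : G ⧸ MulAction.stabilizer G (y n)), rfl⟩
  · exact isClosed_discrete _
  · exact fun _ _ _ _ => rfl
  · refine ⟨range singleton, fun _ _ => isOpen_discrete _, ?_, ?_⟩
    · exact eq_univ_of_forall fun q => ⟨{q}, ⟨q, rfl⟩, rfl⟩
    · rintro _ ⟨q, rfl⟩
      exact injOn_singleton _ _

/-- The stabilizers of `y n` are open, increase with `n` and cover `G`, so one of them contains the
compact generating set. -/
theorem IsBranchOf.exists_fixed_vertex (hy : IsBranchOf hT ξ y ξ')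
    (hfix : ∀ g : G, g • ξ = ξ) (h : ∀ g : G, shift hT hfix g = 0)
    {K : Subgroup G} (hK : IsCompactlyGenerated K) : ∃ v : V, ∀ g ∈ K, g • v = v := by
  obtain ⟨S, hS, rfl⟩ := hK
  have hmono : Monotone fun n : ℕ => (MulAction.stabilizer G (y n) : Set G) := by
    refine monotone_nat_of_le_succ fun n g hg => ?_
    change g • y (n + 1 : ℕ) = y (n + 1 : ℕ)
    rw [Nat.cast_succ, ← hy.parent_eq, smul_parent hT hfix, show g • y n = y n from hg]
  obtain ⟨n, hn⟩ := hS.elim_directed_cover _ (fun n : ℕ => isOpen_stabilizer (G := G) (y n))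
    (fun g _ => by
      obtain ⟨N, hN⟩ := exists_fixed_iterate hT hfix (h g) (y 0)
      have := hN N le_rfl
      rw [hy.iterate, zero_add] at this
      exact mem_iUnion.2 ⟨N, this⟩) hmono.directed_le
  exact ⟨y n, fun g hg => (Subgroup.closure_le _).2 hn hg⟩

/-- Some ancestor of `v` lies on the branch of `ξ'`. It is fixed by `G` too, so transitivity puts it
on all branches. -/
theorem isOpen_singleton_of_fixed_vertex (hne : ξ' ≠ ξ) (hfix : ∀ g : G, g • ξ = ξ)
    (htrans : ∀ η η' : Ends T, η ≠ ξ → η' ≠ ξ → ∃ g : G, g • η = η') (hT : T.IsTree) {v : V}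
    (hv : ∀ g : G, g • v = v) : IsOpen ({ξ} : Set (Ends T)) := by
  obtain ⟨y, hy⟩ := exists_branch (hT := hT) hne
  obtain ⟨k, m, hkm⟩ := exists_common_ancestor hT ξ v (y 0)
  rw [hy.iterate] at hkm
  refine isOpen_singleton_end_iff (hT := hT).2 ⟨(parent hT ξ)^[k] v, fun η hη => ?_⟩
  obtain ⟨g, rfl⟩ := htrans ξ' η hne hη
  have := (smul_mem_shadow_smul_iff (G := G) hfix g).2 (hy.mem_shadow_self (0 + m))
  rwa [← hkm, smul_iterate_parent hT hfix, hv] at this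

theorem IsBranchOf.horocyclicCase (hy : IsBranchOf hT ξ y ξ') (hne : ξ' ≠ ξ)
    (hfin : ∀ v : V, (T.neighborSet v).Finite) (hfix : ∀ g : G, g • ξ = ξ)
    (htrans : ∀ η η' : Ends T, η ≠ ξ → η' ≠ ξ → ∃ g : G, g • η = η')
    (h : ∀ g : G, shift hT hfix g = 0) (hopen : ¬ IsOpen ({ξ} : Set (Ends T))) :
    HorocyclicCase G ξ ξ' hfix hne where
  accumulation := by
    rw [AccPt, principal_univ, inf_top_eq, neBot_iff]
    exact fun hbot => hopen ((isOpen_singleton_iff_punctured_nhds ξ).2 hbot)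
  without_translation := actsWithoutTranslation_of_shift hfin hfix h
  stabilizer_le := by
    rw [hy.lineBetween_eq]
    rintro _ ⟨n, rfl⟩ g hg
    rw [MulAction.mem_stabilizer_iff, hy.smul_apply hfix hg, h, add_zero]
  factorization := by
    rw [hy.lineBetween_eq]
    rintro _ ⟨n, rfl⟩
    exact hy.exists_cdiFactorization hne hfin hfix htrans h n
  fixes_vertex := fun _ hK => hy.exists_fixed_vertex hfix h hK
  not_compactlyGenerated := fun hG => by
    obtain ⟨v, hv⟩ := hy.exists_fixed_vertex hfix h hG
    exact hopen (isOpen_singleton_of_fixed_vertex hne hfix htrans hT fun g => hv g trivial)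
  preserves_horospheres := by
    rintro g _ ⟨v, rfl⟩
    ext w
    rw [mem_smul_set_iff_inv_smul_mem, mem_horosphere_iff hT, mem_horosphere_iff hT,
      height_smul hT hfix, h, add_zero]
  infinite_orbits := by
    refine Infinite.of_surjective (β := ℤ) (Quotient.lift (height hT ξ) ?_) fun n =>
      ⟨Quotient.mk _ (y n), hy.height_eq n⟩
    rintro a b ⟨g, rfl⟩
    change height hT ξ (g • b) = _
    rw [height_smul hT hfix, h, add_zero]

end Horocyclic

/-! ### The focal case. -/

section Focal

variable {hT : T.IsTree} {ξ ξ' : Ends T} {G : Subgroup (T ≃g T)} {y : ℤ → V}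

/-- The element `s` expands shadows along `y` towards `ξ`, and its inverse shrinks them to `ξ'`.
Isolation of `ξ`, or of `ξ'` and so by transitivity of any other end, would force `η = ξ'`. -/
theorem IsBranchOf.not_isOpen_singleton (hy : IsBranchOf hT ξ y ξ')
    (hfix : ∀ g : G, g • ξ = ξ)
    (htrans : ∀ η η' : Ends T, η ≠ ξ → η' ≠ ξ → ∃ g : G, g • η = η')
    {s : G} {l : ℕ} (hl : 0 < l) (hs : s • ξ' = ξ') (hsl : shift hT hfix s = l)
    {η : Ends T} (hη : η ≠ ξ) (hηξ' : η ≠ ξ') (ζ : Ends T) : ¬ IsOpen ({ζ} : Set (Ends T)) := by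
  obtain ⟨z, hz⟩ := exists_branch (hT := hT) hη
  have hl1 : (1 : ℤ) ≤ l := by omega
  have hpow : ∀ (k : ℤ) n, (s ^ k) • y n = y (n + k * l) := fun k n => by
    rw [hy.smul_apply hfix (zpow_mem (MulAction.mem_stabilizer_iff.2 hs : s ∈
      MulAction.stabilizer G ξ') k), shift_zpow, hsl]
  by_cases hζ : ζ = ξ
  · subst hζ
    rw [isOpen_singleton_end_iff (hT := hT)]
    rintro ⟨w, hw⟩
    have hyw := hy.mem_shadow.1 (hw ξ' hy.ne)
    have hall : ∀ k : ℕ, η ∈ shadow hT ζ ((s ^ (-k : ℤ)) • w) := by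
      intro k
      rw [← smul_inv_smul (s ^ (-k : ℤ)) η, smul_mem_shadow_smul_iff hfix]
      exact hw _ (smul_ne_of_ne hfix _ hη)
    refine hηξ' (IsBranchOf.end_unique (y := y) ?_ hy)
    convert hz using 1
    funext n
    -- As `l ≥ 1`, this many applications of `s⁻¹` bring `w` down to height at most `n`, so the
    -- branches of `η` and `ξ'` agree at `n`.
    set k := (height hT ζ w - n).toNat
    have h1 := hall k
    rw [← hyw, hpow] at h1
    have h2 := hz.mem_shadow.1 h1
    rw [hy.height_eq] at h2
    refine hy.eq_of_eq_of_le hz h2.symm ?_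
    have : (k : ℤ) ≤ k * l := le_mul_of_one_le_right (by omega) hl1
    have h3 : height hT ζ w - n ≤ k := by omega
    linarith
  · obtain ⟨a, rfl⟩ := htrans ξ' ζ hy.ne hζ
    intro hopen
    have hya := hy.smul (g := (a : T ≃g T)) (hfix a) (c := shift hT hfix a)
      (height_smul hT hfix a)
    obtain ⟨m, hm⟩ := exists_shadow_subset hya hopen (mem_singleton _)
    have hm' : ∀ ζ, ζ ∈ shadow hT ξ (y (m - shift hT hfix a)) → ζ = ξ' := fun ζ h1 =>
      MulAction.injective a (hm ((smul_mem_shadow_smul_iff (G := G) hfix a).2 h1))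
    set m' := m - shift hT hfix a
    obtain ⟨i, j, hij⟩ := exists_common_ancestor hT ξ (z 0) (y 0)
    rw [hz.iterate, hy.iterate] at hij
    have hηj : η ∈ shadow hT ξ (y j) := by
      have := hz.mem_shadow_self (0 + i)
      rwa [hij, zero_add] at this
    -- Enough applications of `s` to carry the shadow reduced to `ξ'` over one containing `η`.
    set k := (j - m').toNat
    have hk : (j : ℤ) ≤ m' + k * l := by
      have : (k : ℤ) ≤ k * l := le_mul_of_one_le_right (by omega) hl1
      have h3 : j - m' ≤ k := by omega
      linarith
    have h1 := hy.shadow_mono hk hηj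
    simp only at h1
    rw [← hpow, ← smul_inv_smul (s ^ (k : ℤ)) η, smul_mem_shadow_smul_iff hfix] at h1
    have h2 := inv_smul_eq_iff.1 (hm' _ h1)
    refine hηξ' (h2.trans ?_)
    exact zpow_mem (MulAction.mem_stabilizer_iff.2 hs : s ∈ MulAction.stabilizer G ξ') k

theorem nonempty_homeomorph_ends_cantorSet (hT : T.IsTree) (ξ : Ends T)
    (hfin : ∀ v : V, (T.neighborSet v).Finite) (hiso : ∀ ζ : Ends T, ¬ IsOpen {ζ}) :
    Nonempty (Ends T ≃ₜ cantorSet) := by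
  have := compactSpace_ends hT ξ hfin
  have := countable_of_locallyFinite hT.connected hfin
  have := hT.connected.nonempty
  obtain ⟨f, hf⟩ := exists_surjective_nat V
  refine @nonempty_homeomorph_cantorSet _ _ _ ⟨ξ⟩ (fun n => shadow hT ξ (f n))
    (fun n => isClopen_shadow _) (fun a b hab => ?_) hiso
  obtain ⟨v, hv⟩ := exists_shadow_separating hT ξ hab
  obtain ⟨n, rfl⟩ := hf v
  exact ⟨n, hv⟩

/-- Correcting `g` by a power of `s` gives shift zero, hence an element fixing some `s ^ N • y 0`;
conjugating by `s ^ N` lands in the compact stabilizer of `y 0`. -/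
theorem IsBranchOf.isCompactlyGenerated_top (hy : IsBranchOf hT ξ y ξ')
    (hfin : ∀ v : V, (T.neighborSet v).Finite) (hclosed : IsClosed (G : Set (T ≃g T)))
    (hfix : ∀ g : G, g • ξ = ξ)
    {s : G} {l : ℕ} (hl : 0 < l) (hs : s • ξ' = ξ') (hsl : shift hT hfix s = l)
    (hdvd : ∀ g : G, (l : ℤ) ∣ shift hT hfix g) :
    IsCompactlyGenerated (⊤ : Subgroup G) := by
  refine ⟨MulAction.stabilizer G (y 0) ∪ {s},
    (isCompact_stabilizer hT hfin hclosed (y 0)).union isCompact_singleton,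
    eq_top_iff.2 fun g _ => ?_⟩
  set K := Subgroup.closure ((MulAction.stabilizer G (y 0) : Set G) ∪ {s})
  have hsK : s ∈ K := Subgroup.subset_closure (Or.inr (mem_singleton s))
  obtain ⟨q, hq⟩ := hdvd g
  have h0 : shift hT hfix (g * s ^ (-q)) = 0 := by
    rw [shift_mul, shift_zpow, hsl, hq]; ring
  obtain ⟨N, hN⟩ := exists_fixed_iterate hT hfix h0 (y 0)
  -- The fixed vertex is taken at index `N * l` because that is where `s ^ N` sends `y 0`.
  have hNl : N ≤ N * l := Nat.le_mul_of_pos_right N hl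
  have h1 := hN (N * l) hNl
  have hsN : (s ^ N) • y 0 = y (0 + (N * l : ℕ)) := by
    rw [hy.smul_apply hfix (pow_mem (MulAction.mem_stabilizer_iff.2 hs : s ∈
      MulAction.stabilizer G ξ') N), shift_pow, hsl]
    push_cast; rfl
  rw [hy.iterate, ← hsN] at h1
  have h2 : (s ^ N)⁻¹ * (g * s ^ (-q)) * s ^ N ∈ MulAction.stabilizer G (y 0) := by
    rw [MulAction.mem_stabilizer_iff, mul_smul, mul_smul, h1, inv_smul_smul]
  have h3 : (s ^ N)⁻¹ * (g * s ^ (-q)) * s ^ N ∈ K := Subgroup.subset_closure (Or.inl h2)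
  have h4 : g = s ^ N * ((s ^ N)⁻¹ * (g * s ^ (-q)) * s ^ N) * (s ^ N)⁻¹ * s ^ q := by
    group
  rw [h4]
  exact mul_mem (mul_mem (mul_mem (pow_mem hsK N) h3) (inv_mem (pow_mem hsK N))) (zpow_mem hsK q)

/-- Each vertex lies on the branch of some end, which transitivity moves to `ξ'`; on `y` itself,
powers of `s` connect indices congruent modulo `l`. -/
theorem IsBranchOf.mem_orbit_iff (hy : IsBranchOf hT ξ y ξ') (hleaf : Leafless T)
    (hfix : ∀ g : G, g • ξ = ξ)
    (htrans : ∀ η η' : Ends T, η ≠ ξ → η' ≠ ξ → ∃ g : G, g • η = η')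
    {s : G} {l : ℕ} (hs : s • ξ' = ξ') (hsl : shift hT hfix s = l)
    (hdvd : ∀ g : G, (l : ℤ) ∣ shift hT hfix g) {v w : V} :
    w ∈ MulAction.orbit G v ↔ (l : ℤ) ∣ height hT ξ w - height hT ξ v := by
  constructor
  · rintro ⟨g, rfl⟩
    have := height_smul hT hfix g v
    change (l : ℤ) ∣ height hT ξ (g • v) - _
    rw [this, add_sub_cancel_left]
    exact hdvd g
  · have hline : ∀ v, ∃ (g : G) (n : ℤ), g • y n = v := by
      intro v
      obtain ⟨η, hη⟩ := shadow_nonempty (hT := hT) (ξ := ξ) hleaf v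
      have h1 : η ≠ ξ := by rintro rfl; exact not_mem_shadow_end v hη
      obtain ⟨g, rfl⟩ := htrans ξ' η hy.ne h1
      rw [← smul_inv_smul g v, smul_mem_shadow_smul_iff hfix] at hη
      exact ⟨g, _, by rw [hy.mem_shadow.1 hη, smul_inv_smul]⟩
    obtain ⟨a, m, rfl⟩ := hline v
    obtain ⟨b, n, rfl⟩ := hline w
    rw [height_smul hT hfix, height_smul hT hfix, hy.height_eq, hy.height_eq]
    intro h
    have h1 : (l : ℤ) ∣ n - m := by
      have := (h.sub (hdvd b)).add (hdvd a)
      rwa [show n + shift hT hfix b - (m + shift hT hfix a) - shift hT hfix b +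
        shift hT hfix a = n - m by ring] at this
    obtain ⟨k, hk⟩ := h1
    refine ⟨b * s ^ k * a⁻¹, ?_⟩
    change (b * s ^ k * a⁻¹) • a • y m = b • y n
    rw [mul_smul, inv_smul_smul, mul_smul, hy.smul_apply hfix (zpow_mem
      (MulAction.mem_stabilizer_iff.2 hs : s ∈ MulAction.stabilizer G ξ') k), shift_zpow, hsl,
      show m + k * (l : ℤ) = n by linarith]

/-- Heights are 1-Lipschitz, which gives the lower bound; the branch `y` crosses both horospheres
and attains it. -/
theorem IsBranchOf.setDist_horosphere (hy : IsBranchOf hT ξ y ξ') (a b : V) :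
    setDist T (horosphere ξ a) (horosphere ξ b) =
      (height hT ξ a - height hT ξ b).natAbs := by
  have hdist : ∀ m n : ℤ, m ≤ n → T.dist (y m) (y n) = (m - n).natAbs := by
    intro m n hmn
    obtain ⟨k, rfl⟩ := Int.exists_add_of_le hmn
    rw [← hy.iterate, dist_iterate_parent]
    omega
  have hdist' : ∀ m n : ℤ, T.dist (y m) (y n) = (m - n).natAbs := by
    intro m n
    rcases le_total m n with h | h
    · exact hdist m n h
    · rw [SimpleGraph.dist_comm, hdist n m h]; omega
  have hmem : (height hT ξ a - height hT ξ b).natAbs ∈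
      {d | ∃ u ∈ horosphere ξ a, ∃ w ∈ horosphere ξ b, d = T.dist u w} :=
    ⟨y (height hT ξ a), by rw [mem_horosphere_iff hT, hy.height_eq],
      y (height hT ξ b), by rw [mem_horosphere_iff hT, hy.height_eq], (hdist' _ _).symm⟩
  refine le_antisymm (Nat.sInf_le hmem) (le_csInf ⟨_, hmem⟩ ?_)
  rintro d ⟨u, hu, w, hw, rfl⟩
  rw [mem_horosphere_iff hT] at hu hw
  have := abs_height_sub_le_dist (ξ := ξ) hT u w
  rw [Int.abs_eq_natAbs] at this
  rw [hu, hw]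
  exact_mod_cast this

theorem IsBranchOf.focalCase (hy : IsBranchOf hT ξ y ξ')
    (hfin : ∀ v : V, (T.neighborSet v).Finite) (hleaf : Leafless T)
    (hclosed : IsClosed (G : Set (T ≃g T))) (hfix : ∀ g : G, g • ξ = ξ)
    (htrans : ∀ η η' : Ends T, η ≠ ξ → η' ≠ ξ → ∃ g : G, g • η = η')
    {s : G} {l : ℕ} (hl : 0 < l) (hs : s • ξ' = ξ') (hsl : shift hT hfix s = l)
    (hdvd : ∀ g : G, (l : ℤ) ∣ shift hT hfix g)
    {η : Ends T} (hη : η ≠ ξ) (hηξ' : η ≠ ξ') : FocalCase G ξ ξ' := by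
  have horb : ∀ v w : V, w ∈ MulAction.orbit G v ↔
      (l : ℤ) ∣ height hT ξ w - height hT ξ v := fun v w =>
    hy.mem_orbit_iff hleaf hfix htrans hs hsl hdvd
  refine ⟨nonempty_homeomorph_ends_cantorSet hT ξ hfin
    (hy.not_isOpen_singleton hfix htrans hl hs hsl hη hηξ'),
    hy.isCompactlyGenerated_top hfin hclosed hfix hl hs hsl hdvd,
    s, l, hy.isTranslationTowards hfix hs hl hsl,
    hy.isSemidirectDecomposition hfix hl hs hsl hdvd, ?_, ?_, ?_⟩
  · let f : MulAction.orbitRel.Quotient G V → ZMod l :=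
      Quotient.lift (fun v => (height hT ξ v : ZMod l)) fun a b hab =>
        ((ZMod.intCast_eq_intCast_iff_dvd_sub _ _ _).2 ((horb b a).1 hab)).symm
    have hf : Function.Bijective f := by
      constructor
      · intro a b
        induction a using Quotient.inductionOn
        induction b using Quotient.inductionOn
        intro hab
        exact Quotient.sound ((horb _ _).2
          ((ZMod.intCast_eq_intCast_iff_dvd_sub _ _ _).1 (Eq.symm hab)))
      · intro n
        obtain ⟨k, rfl⟩ := ZMod.intCast_surjective n
        exact ⟨Quotient.mk _ (y k), congrArg Int.cast (hy.height_eq k)⟩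
    rw [Nat.card_congr (Equiv.ofBijective f hf), Nat.card_zmod]
  · intro v
    refine ⟨{A | ∃ w ∈ MulAction.orbit G v, A = horosphere ξ w}, ?_, ?_⟩
    · rintro _ ⟨w, -, rfl⟩
      exact ⟨w, rfl⟩
    · ext w
      constructor
      · exact fun hw => ⟨_, ⟨w, hw, rfl⟩, (mem_horosphere_iff hT).2 rfl⟩
      · rintro ⟨_, ⟨u, hu, rfl⟩, hw⟩
        rw [mem_horosphere_iff hT] at hw
        rwa [horb, ← hw, ← horb]
  · rintro _ _ ⟨a, rfl⟩ ⟨b, rfl⟩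
    rw [hy.setDist_horosphere, ← Int.natCast_dvd]
    constructor
    · rintro ⟨v, ha, hb⟩
      have h1 := (horb v a).1 (ha ((mem_horosphere_iff hT).2 rfl))
      have h2 := (horb v b).1 (hb ((mem_horosphere_iff hT).2 rfl))
      simpa using h1.sub h2
    · intro h
      refine ⟨b, fun w hw => ?_, fun w hw => ?_⟩
      · rw [mem_horosphere_iff hT] at hw
        rwa [horb, ← hw]
      · rw [mem_horosphere_iff hT] at hw
        rw [horb, ← hw]
        simp

end Focal

/-! ### Mutual exclusion of the cases. -/

section Exclusion

variable {ξ ξ' : Ends T} {G : Subgroup (T ≃g T)}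

theorem LinealCase.not_actsWithoutTranslation (h : LinealCase G ξ ξ') :
    ¬ ActsWithoutTranslation G := by
  intro hG
  obtain ⟨e⟩ := h.eq_int
  let g : G := e.symm (Multiplicative.ofAdd 1)
  refine hG g g.2 (h.translation g g.2 fun hg => ?_)
  have h1 : g = 1 := Subtype.ext hg
  have h2 : e g = 1 := by rw [h1, map_one]
  have h3 : e g = Multiplicative.ofAdd 1 := e.apply_symm_apply _
  have h4 := congrArg Multiplicative.toAdd (h3.symm.trans h2)
  simp at h4

theorem FocalCase.not_actsWithoutTranslation (h : FocalCase G ξ ξ') :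
    ¬ ActsWithoutTranslation G := by
  obtain ⟨s, l, hs, -⟩ := h.exists_translation
  exact fun hG => hG s s.2 ⟨l, ξ, hs⟩

/-- If `ξ'` is fixed, transitivity leaves only the two ends `ξ` and `ξ'`, whereas the Cantor set is
infinite. -/
theorem FocalCase.not_linealCase (hne : ξ' ≠ ξ)
    (htrans : ∀ η η' : Ends T, η ≠ ξ → η' ≠ ξ → ∃ g : G, g • η = η')
    (h : FocalCase G ξ ξ') : ¬ LinealCase G ξ ξ' := by
  intro hL
  obtain ⟨e⟩ := h.cantor
  have hfinite : (univ : Set (Ends T)).Finite := by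
    refine (toFinite {ξ, ξ'}).subset fun η _ => ?_
    by_cases hη : η = ξ
    · exact Or.inl hη
    · obtain ⟨g, rfl⟩ := htrans ξ' η hne hη
      have : g ∈ MulAction.stabilizer G ξ' := hL.eq_stabilizer ▸ Subgroup.mem_top g
      exact Or.inr this
  have h1 : Finite (Ends T) := finite_univ_iff.1 hfinite
  have h2 : Finite (ℕ → Bool) :=
    Finite.of_equiv _ (e.toEquiv.trans cantorSetHomeomorphNatToBool.toEquiv)
  exact not_finite (ℕ → Bool)

end Exclusion

end TreeEnds

theorem lemma3p17 {V : Type*} (T : SimpleGraph V) (hT : T.IsTree)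
    (hfin : ∀ v : V, (T.neighborSet v).Finite) (hleaf : TreeEnds.Leafless T)
    (G : Subgroup (T ≃g T)) (hclosed : IsClosed (G : Set (T ≃g T)))
    (ξ : TreeEnds.Ends T) (hfix : ∀ g : G, g • ξ = ξ)
    (htrans : ∀ η η' : TreeEnds.Ends T, η ≠ ξ → η' ≠ ξ → ∃ g : G, g • η = η')
    (ξ' : TreeEnds.Ends T) (hne : ξ' ≠ ξ) :
    TreeEnds.IsCompactlyGenerated (MulAction.stabilizer G ξ') ∧
    (TreeEnds.IsolatedEndCase G ξ ∨ TreeEnds.LinealCase G ξ ξ' ∨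
      TreeEnds.HorocyclicCase G ξ ξ' hfix hne ∨ TreeEnds.FocalCase G ξ ξ') ∧
    ¬ (TreeEnds.IsolatedEndCase G ξ ∧ TreeEnds.LinealCase G ξ ξ') ∧
    ¬ (TreeEnds.IsolatedEndCase G ξ ∧ TreeEnds.HorocyclicCase G ξ ξ' hfix hne) ∧
    ¬ (TreeEnds.IsolatedEndCase G ξ ∧ TreeEnds.FocalCase G ξ ξ') ∧
    ¬ (TreeEnds.LinealCase G ξ ξ' ∧ TreeEnds.HorocyclicCase G ξ ξ' hfix hne) ∧
    ¬ (TreeEnds.LinealCase G ξ ξ' ∧ TreeEnds.FocalCase G ξ ξ') ∧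
    ¬ (TreeEnds.HorocyclicCase G ξ ξ' hfix hne ∧ TreeEnds.FocalCase G ξ ξ') := by
  obtain ⟨y, hy⟩ := TreeEnds.exists_branch (hT := hT) hne
  refine ⟨hy.isCompactlyGenerated_stabilizer hfix htrans hfin hclosed, ?_,
    fun h => h.2.not_actsWithoutTranslation h.1.without_translation, fun h => ?_,
    fun h => h.2.not_actsWithoutTranslation h.1.without_translation,
    fun h => h.1.not_actsWithoutTranslation h.2.without_translation,
    fun h => h.2.not_linealCase hne htrans h.1,
    fun h => h.2.not_actsWithoutTranslation h.1.without_translation⟩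
  -- A nontrivial shift leads to the lineal or focal case, a trivial one to the isolated or
  -- horocyclic case.
  · by_cases h : ∃ g : G, TreeEnds.shift hT hfix g ≠ 0
    · obtain ⟨s, l, hl, hs, hsl, hdvd⟩ :=
        TreeEnds.exists_minimal_translation hfix htrans hne h
      by_cases hX : ∀ η, η ≠ ξ → η = ξ'
      · exact Or.inr (Or.inl (hy.linealCase hleaf hfix hl hsl hdvd hX))
      · push Not at hX
        obtain ⟨η, hη, hηξ'⟩ := hX
        exact Or.inr (Or.inr (Or.inr
          (hy.focalCase hfin hleaf hclosed hfix htrans hl hs hsl hdvd hη hηξ')))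
    · push Not at h
      by_cases hopen : IsOpen ({ξ} : Set (TreeEnds.Ends T))
      · exact Or.inl (TreeEnds.isolatedEndCase_of_isOpen hfin hfix h hopen)
      · exact Or.inr (Or.inr (Or.inl (hy.horocyclicCase hne hfin hfix htrans h hopen)))
  · have hacc := h.2.accumulation
    rw [AccPt, principal_univ, inf_top_eq, neBot_iff] at hacc
    exact hacc ((isOpen_singleton_iff_punctured_nhds ξ).1 h.1.isolated)
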